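/- Let $\mathbb{K}$ be a field of characteristic zero, and let $\mathbb{K}[x,\partial]$ be the associative algebra $\mathbb{K}\langle x,\partial;\ \partial x = x\partial + 1\rangle$ of linear differential operators with polynomial coefficients. For $d,r\ge 1$ let $\mathbb{K}[x,\partial]_{d,r}$ be the set of operators $\sum_{i<d,\,j<r} a_{i,j}\,x^i\partial^j$ with $a_{i,j}\in\mathbb{K}$; such an operator is represented by its coefficients $a_{i,j}$. Costs are numbers of field operations ($+,-,\times,/$) in $\mathbb{K}$ performed by straight-line programs, which never divide by zero and whose constants are taken from a fixed set $S\subseteq\mathbb{K}$ that contains $0$ and $1$ (for instance $S=\{0,1\}$ or $S=\mathbb{K}$). Let $\mathsf{M}:\mathbb{N}\to\mathbb{R}$ be such that, for each $n\ge 1$, polynomials of degree less than $n$ in $\mathbb{K}[x]$ can be multiplied in at most $\mathsf{M}(n)$ operations, and such that $\mathsf{M}(n)/n$ is non-decreasing for $n\ge 1$. Let $\omega$ be a feasible exponent of matrix multiplication over $\mathbb{K}$, that is, a real number with $2\le\omega\le 3$ such that $n\times n$ matrices over $\mathbb{K}$ can be multiplied in $\mathcal{O}(n^{\omega})$ operations.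 Then there is a constant $C$ such that, for all integers $r\ge d\ge 1$, there is a program that computes from the coefficients of any two operators $K,L\in\mathbb{K}[x,\partial]_{d,r}$ the coefficients of the product $KL\in\mathbb{K}[x,\partial]_{2d,2r}$ in at most $$C\left(d^{\omega-1}\,r + d\,\mathsf{M}(r)\log r\right)$$ operations in $\mathbb{K}$. -/

import Mathlib

/-- The four arithmetic operations of a field. -/
inductive FieldOp where
  | add
  | sub
  | mul
  | div

open Classical in
/-- The result of an arithmetic operation; a division by zero has no result. -/
noncomputable def FieldOp.eval {F : Type*} [Field F] : FieldOp → F → F → Option F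
  | .add, a, b => some (a + b)
  | .sub, a, b => some (a - b)
  | .mul, a, b => some (a * b)
  | .div, a, b => if b = 0 then none else some (a / b)

/-- An operand of an instruction: one of the inputs (indexed by `ι`), a constant from the set `S`,
or the result of an earlier instruction (instructions are numbered from `0`). -/
inductive Operand {F : Type*} (S : Set F) (ι : Type*) where
  | input (i : ι)
  | const (c : S)
  | reg (k : ℕ)

/-- The value of an operand, given the inputs and the list of the results of the instructions
executed so far; a reference to an instruction not yet executed has no value. -/
def Operand.eval {F : Type*} {S : Set F} {ι : Type*} (x : ι → F) (mem : List F) :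
    Operand S ι → Option F
  | .input i => some (x i)
  | .const c => some (c : F)
  | .reg k => mem[k]?

/-- An instruction: one arithmetic operation applied to two operands. -/
structure Instr {F : Type*} (S : Set F) (ι : Type*) where
  op : FieldOp
  left : Operand S ι
  right : Operand S ι

/-- Execution of a list of instructions, starting from a list of earlier results: each instruction
appends its result.  The execution fails as soon as an operand or a result does not exist. -/
noncomputable def runInstrs {F : Type*} [Field F] {S : Set F} {ι : Type*} (x : ι → F) :
    List (Instr S ι) → List F → Option (List F)
  | [], mem => some mem
  | I :: Is, mem =>
    (I.left.eval x mem).bind fun a =>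
      (I.right.eval x mem).bind fun b =>
        (I.op.eval a b).bind fun v => runInstrs x Is (mem ++ [v])

/-- A straight-line program over a field `F`, with inputs indexed by `ι`, outputs indexed by `o`,
and constants taken from the set `S`. -/
structure SLP {F : Type*} (S : Set F) (ι o : Type*) where
  instrs : List (Instr S ι)
  outputs : o → Operand S ι

/-- The cost of a program: the number of field operations that it performs. -/
def SLP.cost {F : Type*} {S : Set F} {ι o : Type*} (P : SLP S ι o) : ℕ :=
  P.instrs.length

/-- On input `x`, the program `P` runs without failure (in particular without dividing by zero) and
its output is `y`. -/
def SLP.Outputs {F : Type*} [Field F] {S : Set F} {ι o : Type*} (P : SLP S ι o)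
    (x : ι → F) (y : o → F) : Prop :=
  ∃ mem : List F, runInstrs x P.instrs [] = some mem ∧
    ∀ j : o, (P.outputs j).eval x mem = some (y j)

/-- Polynomials of degree less than `n`, given by their coefficients, can be multiplied
by a single program with constants in `S` that uses at most `t` field operations. -/
def PolynomialsMulWithin {F : Type*} [Field F] (S : Set F) (n : ℕ) (t : ℝ) : Prop :=
  ∃ P : SLP S (Fin n ⊕ Fin n) (Fin (2 * n)), (P.cost : ℝ) ≤ t ∧
    ∀ p q : Polynomial F, p.degree < n → q.degree < n →
      P.Outputs (Sum.elim (fun i => p.coeff i) (fun i => q.coeff i))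
        (fun k => (p * q).coeff k)

/-- Matrices of size `n × n` can be multiplied by a single program with constants in `S` that uses
at most `t` field operations. -/
def MatricesMulWithin {F : Type*} [Field F] (S : Set F) (n : ℕ) (t : ℝ) : Prop :=
  ∃ P : SLP S ((Fin n × Fin n) ⊕ (Fin n × Fin n)) (Fin n × Fin n), (P.cost : ℝ) ≤ t ∧
    ∀ A B : Matrix (Fin n) (Fin n) F,
      P.Outputs (Sum.elim (fun ij => A ij.1 ij.2) (fun ij => B ij.1 ij.2))
        (fun ij => (A * B) ij.1 ij.2)

/-- The two generators of the algebra of linear differential operators: multiplication by the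
variable, and differentiation. -/
inductive DiffGen where
  | x
  | partial_x

/-- The defining relation `∂ x = x ∂ + 1`. -/
inductive DiffRel (F : Type*) [Field F] :
    FreeAlgebra F DiffGen → FreeAlgebra F DiffGen → Prop
  | leibniz : DiffRel F
      (FreeAlgebra.ι F DiffGen.partial_x * FreeAlgebra.ι F DiffGen.x)
      (FreeAlgebra.ι F DiffGen.x * FreeAlgebra.ι F DiffGen.partial_x + 1)

/-- The associative algebra `F⟨x, ∂ ; ∂ x = x ∂ + 1⟩` of linear differential operators with
polynomial coefficients. -/
abbrev DiffOp (F : Type*) [Field F] : Type _ := RingQuot (DiffRel F)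

/-- The operator `x`. -/
noncomputable def DiffOp.x (F : Type*) [Field F] : DiffOp F :=
  RingQuot.mkAlgHom F (DiffRel F) (FreeAlgebra.ι F DiffGen.x)

/-- The operator `∂`. -/
noncomputable def DiffOp.del (F : Type*) [Field F] : DiffOp F :=
  RingQuot.mkAlgHom F (DiffRel F) (FreeAlgebra.ι F DiffGen.partial_x)

/-- The operator `∑ a i j • x ^ i * ∂ ^ j` of bidegree less than `(d, r)` in `(x, ∂)`, with sum
over `i < d` and `j < r`, that has the coefficients `a`. -/
noncomputable def DiffOp.ofCoeffs {F : Type*} [Field F] {d r : ℕ} (a : Fin d × Fin r → F) :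
    DiffOp F :=
  ∑ ij : Fin d × Fin r, a ij • (DiffOp.x F ^ (ij.1 : ℕ) * DiffOp.del F ^ (ij.2 : ℕ))

/-- Linear differential operators of bidegree less than `(d, r)` in `(x, ∂)`, given by their
coefficients, can be multiplied by a single program with constants in `S` that uses at most `t`
field operations.  The program returns the coefficients of the product, which has bidegree less
than `(2 * d, 2 * r)`. -/
def OperatorsMulWithin {F : Type*} [Field F] (S : Set F) (d r : ℕ) (t : ℝ) : Prop :=
  ∃ P : SLP S ((Fin d × Fin r) ⊕ (Fin d × Fin r)) (Fin (2 * d) × Fin (2 * r)), (P.cost : ℝ) ≤ t ∧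
    ∀ a b : Fin d × Fin r → F, ∃ c : Fin (2 * d) × Fin (2 * r) → F,
      P.Outputs (Sum.elim a b) c ∧
        DiffOp.ofCoeffs c = DiffOp.ofCoeffs a * DiffOp.ofCoeffs b

/-!
The product `K L` is computed by evaluation and interpolation. An operator
`L = ∑ x ^ i * p i (∂)`, `i < d`, maps `exp (k x) * P` to `exp (k x)` times the image of `P` under
`∑ x ^ i * p i (∂ + k)`, and raises the degree of the factor `P` by less than `d`. Its action on the
factors of degree less than `d` is therefore a matrix with `O(d)` rows and columns, which depends
only on the `p i` modulo `(∂ - k) ^ O(d)`. With about `2 r / d` integers `k` these matrices determine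
the product, which has degree less than `2 r` in `∂`; multiplying them costs
`O((r / d) * d ^ ω)` operations, and passing between local coefficients and matrix entries is one
convolution with `exp (± x)` for each diagonal (`actMat_mul`, `computes_actMat`,
`computes_of_actMat`).

It remains to expand polynomials of degree less than `N = O(r)` at the points `k < 2 ^ J`
(`computes_eval`), and to interpolate (`computes_interp`), with `O(M(r) log r)` operations for each
of the `O(d)` polynomials. Both use a binary tree. As the points are consecutive integers, the
moduli at one level are translates of a single polynomial `nodal F e (2 ^ j)`, and a translation of
the variable is a convolution because the characteristic is zero. The tree of the expansion carries
the moments `mom`, the coefficients of the negative powers of the variable in the expansion at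
infinity of the quotient of the polynomial by the modulus: multiplication by the
complementary modulus sends the moments at a node to those at its children (`mom_eq_sum`,
`momShift_eq_sum`, `mom_taylor`), so that no division with remainder occurs below the root. The
tree of the interpolation is the usual combination of residues (`comb_taylor`).

Costs are bounded for sets of values, that is, of functions of the input: `Computes S A B t` says
that the values in `B` are obtained from those in `A` with `t` operations. Programs and such
computations are equivalent (`Computes.exists_slp`, `SLP.computes`). For fixed `r`, monotonicity of
`M n / n` makes the cost of a convolution linear in its length up to the length `16 * r`, with
slope `O(M r / r)` (`convBound_of_polynomialsMulWithin`), so the nodes of one level of a tree cost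
no more together than its root.
-/

namespace OpMul

open Polynomial

/-! ### Straight-line computations -/

section Framework

variable {F : Type*} [Field F] {Ω : Type*}

/-- The constants in `S`, as values, that is, as functions of the input `x : Ω`. -/
def consts (S : Set F) (Ω : Type*) : Set (Ω → F) :=
  Set.range fun (c : S) (_ : Ω) => (c : F)

/-- `Derives S A B n`: at most `n` instructions lead from the values in `A` to a set of values that
contains `B`. A value is a function on the space `Ω` of inputs, so that one derivation treats all
inputs at once. -/
inductive Derives (S : Set F) : Set (Ω → F) → Set (Ω → F) → ℕ → Prop
  | done {A B : Set (Ω → F)} (n : ℕ) (h : B ⊆ A ∪ consts S Ω) : Derives S A B n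
  | step {A B : Set (Ω → F)} {n : ℕ} (op : FieldOp) (a b v : Ω → F) (ha : a ∈ A ∪ consts S Ω)
      (hb : b ∈ A ∪ consts S Ω) (hv : ∀ x, op.eval (a x) (b x) = some (v x))
      (h : Derives S (insert v A) B n) : Derives S A B (n + 1)

variable {S : Set F}

theorem Derives.mono {A A' B B' : Set (Ω → F)} {n : ℕ} (h : Derives S A B n) (hA : A ⊆ A')
    (hB : B' ⊆ B) : Derives S A' B' n := by
  induction h generalizing A' with
  | done n h => exact .done n (hB.trans (h.trans (Set.union_subset_union_left _ hA)))
  | step op a b v ha hb hv h ih =>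
    exact .step op a b v (Set.union_subset_union_left _ hA ha)
      (Set.union_subset_union_left _ hA hb) hv (ih (Set.insert_subset_insert hA) hB)

theorem Derives.le {A B : Set (Ω → F)} {n m : ℕ} (h : Derives S A B n) (hnm : n ≤ m) :
    Derives S A B m := by
  induction h generalizing m with
  | done n h => exact .done m h
  | step op a b v ha hb hv h ih =>
    obtain ⟨k, rfl⟩ : ∃ k, m = k + 1 := ⟨m - 1, by omega⟩
    exact .step op a b v ha hb hv (ih (by omega))

theorem Derives.seq {A B C : Set (Ω → F)} {n m : ℕ} (h : Derives S A B n)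
    (h' : Derives S (A ∪ B) C m) : Derives S A (B ∪ C) (n + m) := by
  induction h with
  | @done A B n h =>
    refine Derives.le (n := m) ?_ (by omega)
    -- The values of `B` are constants or lie in `A`, so they are not missed by a derivation from
    -- `A ∪ B`.
    have key : ∀ (A₁ : Set (Ω → F)) (C : Set (Ω → F)) (m : ℕ), Derives S A₁ C m →
        ∀ A₂, A₁ ⊆ A₂ ∪ consts S Ω → B ⊆ A₂ ∪ consts S Ω → Derives S A₂ (B ∪ C) m := by
      intro A₁ C m h
      induction h with
      | done n h =>
        intro A₂ h1 h2
        refine .done _ (Set.union_subset h2 (h.trans (Set.union_subset h1 ?_)))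
        exact Set.subset_union_right
      | step op a b v ha hb hv h ih =>
        intro A₂ h1 h2
        have h3 := Set.union_subset h1 (Set.subset_union_right (s := A₂) (t := consts S Ω))
        refine .step op a b v (h3 ha) (h3 hb) hv (ih _ ?_ ?_)
        · rintro w (rfl | hw)
          · exact .inl (.inl rfl)
          · rcases h1 hw with h | h
            · exact .inl (.inr h)
            · exact .inr h
        · intro w hw
          rcases h2 hw with h | h
          · exact .inl (.inr h)
          · exact .inr h
    exact key _ _ _ h' A (Set.union_subset Set.subset_union_left h) h
  | @step A B n op a b v ha hb hv h ih =>
    have := ih (h'.mono (Set.union_subset_union_left _ (Set.subset_insert v A)) subset_rfl)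
    rw [Nat.add_right_comm]
    exact .step op a b v ha hb hv this

/-- From the values in `A` and the constants in `S`, the values in `B` can be computed with at
most `t` field operations. -/
def Computes (S : Set F) (A B : Set (Ω → F)) (t : ℝ) : Prop :=
  ∃ n : ℕ, (n : ℝ) ≤ t ∧ Derives S A B n

namespace Computes

variable {A A' B B' C : Set (Ω → F)} {s t : ℝ}

theorem mono (h : Computes S A B s) (hA : A ⊆ A') (hB : B' ⊆ B) (hs : s ≤ t) :
    Computes S A' B' t := by
  obtain ⟨n, hn, h⟩ := h
  exact ⟨n, hn.trans hs, h.mono hA hB⟩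

theorem le (h : Computes S A B s) (hs : s ≤ t) : Computes S A B t :=
  h.mono subset_rfl subset_rfl hs

theorem left (h : Computes S A B s) (hA : A ⊆ A') : Computes S A' B s :=
  h.mono hA subset_rfl le_rfl

theorem right (h : Computes S A B s) (hB : B' ⊆ B) : Computes S A B' s :=
  h.mono subset_rfl hB le_rfl

theorem of_subset (h : B ⊆ A) (ht : 0 ≤ t) : Computes S A B t :=
  ⟨0, by simpa using ht, .done 0 (h.trans Set.subset_union_left)⟩

theorem of_mem {a : Ω → F} (h : a ∈ A) : Computes S A {a} 0 :=
  of_subset (by simpa using h) le_rfl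

theorem const {c : F} (h : c ∈ S) : Computes S A {fun _ => c} 0 :=
  ⟨0, by simp, .done 0 (by
    rintro _ rfl
    exact .inr ⟨⟨c, h⟩, rfl⟩)⟩

theorem seq (h : Computes S A B s) (h' : Computes S (A ∪ B) C t) :
    Computes S A (B ∪ C) (s + t) := by
  obtain ⟨n, hn, h⟩ := h
  obtain ⟨m, hm, h'⟩ := h'
  exact ⟨n + m, by push_cast; linarith, h.seq h'⟩

theorem trans (h : Computes S A B s) (h' : Computes S (A ∪ B) C t) :
    Computes S A C (s + t) :=
  (h.seq h').right Set.subset_union_right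

theorem union (h : Computes S A B s) (h' : Computes S A C t) :
    Computes S A (B ∪ C) (s + t) :=
  h.seq (h'.left Set.subset_union_left)

/-- A set each of whose elements is available or is a constant of `S` costs nothing. -/
theorem of_forall (h : ∀ b ∈ B, Computes S A {b} 0) : Computes S A B 0 := by
  refine ⟨0, by simp, .done 0 ?_⟩
  intro b hb
  obtain ⟨n, hn, h⟩ := h b hb
  obtain rfl : n = 0 := by
    have : (n : ℝ) = 0 := le_antisymm hn (by positivity)
    exact_mod_cast this
  cases h with
  | done _ h => exact h rfl

theorem biUnion {ι : Type*} (I : Finset ι) {B : ι → Set (Ω → F)} {t : ι → ℝ}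
    (h : ∀ i ∈ I, Computes S A (B i) (t i)) :
    Computes S A (⋃ i ∈ I, B i) (∑ i ∈ I, t i) := by
  classical
  induction I using Finset.induction_on with
  | empty => exact (of_subset (Set.empty_subset _) le_rfl).mono subset_rfl (by simp) (by simp)
  | insert i I hi ih =>
    rw [Finset.sum_insert hi, Finset.set_biUnion_insert]
    exact (h i (by simp)).union (ih fun k hk => h k (by simp [hk]))

theorem biUnion_lt {n : ℕ} {B : ℕ → Set (Ω → F)} (h : ∀ i < n, Computes S A (B i) t) :
    Computes S A (⋃ i ∈ Finset.range n, B i) (n * t) := by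
  have := biUnion (Finset.range n) (fun i hi => h i (Finset.mem_range.1 hi))
  simpa using this

/-- A loop whose `i`-th round may use the results of the previous rounds. -/
theorem accumulate {n : ℕ} {B : ℕ → Set (Ω → F)}
    (h : ∀ i < n, Computes S (A ∪ ⋃ j ∈ Finset.range i, B j) (B i) t) :
    Computes S A (⋃ i ∈ Finset.range n, B i) (n * t) := by
  induction n with
  | zero => exact of_subset (by simp) (by simp)
  | succ n ih =>
    refine ((ih fun i hi => h i (by omega)).seq (h n (by omega))).mono subset_rfl ?_ ?_
    · rw [Finset.range_add_one, Finset.set_biUnion_insert, Set.union_comm]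
    · push_cast; linarith

theorem apply_op (op : FieldOp) {a b v : Ω → F} (ha : Computes S A {a} s)
    (hb : Computes S A {b} t) (hv : ∀ x, op.eval (a x) (b x) = some (v x)) :
    Computes S A {v} (s + t + 1) := by
  refine trans (B := {a} ∪ {b}) (ha.union hb) ⟨1, by simp, ?_⟩
  exact .step op a b v (.inl (by simp)) (.inl (by simp)) hv (.done 0 (.trans (by simp)
    Set.subset_union_left))

theorem add {a b : Ω → F} (ha : Computes S A {a} s) (hb : Computes S A {b} t) :
    Computes S A {fun x => a x + b x} (s + t + 1) :=
  apply_op .add ha hb fun _ => rfl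

theorem add_eq {a b v : Ω → F} {u : ℝ} (ha : Computes S A {a} s) (hb : Computes S A {b} t)
    (hu : s + t + 1 ≤ u) (hv : ∀ x, v x = a x + b x) : Computes S A {v} u := by
  obtain rfl : v = fun x => a x + b x := funext hv
  exact (ha.add hb).le hu

theorem sub {a b : Ω → F} (ha : Computes S A {a} s) (hb : Computes S A {b} t) :
    Computes S A {fun x => a x - b x} (s + t + 1) :=
  apply_op .sub ha hb fun _ => rfl

theorem sub_eq {a b v : Ω → F} {u : ℝ} (ha : Computes S A {a} s) (hb : Computes S A {b} t)
    (hu : s + t + 1 ≤ u) (hv : ∀ x, v x = a x - b x) : Computes S A {v} u := by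
  obtain rfl : v = fun x => a x - b x := funext hv
  exact (ha.sub hb).le hu

theorem mul {a b : Ω → F} (ha : Computes S A {a} s) (hb : Computes S A {b} t) :
    Computes S A {fun x => a x * b x} (s + t + 1) :=
  apply_op .mul ha hb fun _ => rfl

theorem mul_eq {a b v : Ω → F} {u : ℝ} (ha : Computes S A {a} s) (hb : Computes S A {b} t)
    (hu : s + t + 1 ≤ u) (hv : ∀ x, v x = a x * b x) : Computes S A {v} u := by
  obtain rfl : v = fun x => a x * b x := funext hv
  exact (ha.mul hb).le hu

theorem div_eq {a b v : Ω → F} {u : ℝ} (ha : Computes S A {a} s) (hb : Computes S A {b} t)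
    (hu : s + t + 1 ≤ u) (h0 : ∀ x, b x ≠ 0) (hv : ∀ x, v x = a x / b x) :
    Computes S A {v} u := by
  obtain rfl : v = fun x => a x / b x := funext hv
  exact (apply_op .div ha hb fun x => by simp [FieldOp.eval, h0 x]).le hu

/-- A constant of `S`, as a value. -/
theorem const_eq {c : F} (h : c ∈ S) {v : Ω → F} (hv : ∀ x, v x = c) (ht : 0 ≤ t) :
    Computes S A {v} t := by
  obtain rfl : v = fun _ => c := funext hv
  exact (const h).le ht

end Computes

/-! ### Straight-line programs -/

/-- The memory of the program is the list `vs` of values, evaluated at the input. -/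
theorem Derives.exists_instrs {ι : Type*} {A B : Set ((ι → F) → F)} {n : ℕ}
    (h : Derives S A B n) (vs : List ((ι → F) → F))
    (hA : ∀ a ∈ A, ∃ o : Operand S ι, ∀ x, o.eval x (vs.map fun v => v x) = some (a x)) :
    ∃ (Is : List (Instr S ι)) (ws : List ((ι → F) → F)), Is.length ≤ n ∧
      (∀ x, runInstrs x Is (vs.map fun v => v x) = some (ws.map fun v => v x)) ∧
      ∀ b ∈ B, ∃ o : Operand S ι, ∀ x, o.eval x (ws.map fun v => v x) = some (b x) := by
  induction h generalizing vs with
  | @done A B n h =>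
    refine ⟨[], vs, by simp, fun x => rfl, fun b hb => ?_⟩
    rcases h hb with h | ⟨c, rfl⟩
    · exact hA b h
    · exact ⟨.const c, fun x => rfl⟩
  | @step A B n op a b v ha hb hv h ih =>
    have hop : ∀ a ∈ A ∪ consts S (ι → F),
        ∃ o : Operand S ι, ∀ x, o.eval x (vs.map fun v => v x) = some (a x) := by
      rintro a (h | ⟨c, rfl⟩)
      · exact hA a h
      · exact ⟨.const c, fun x => rfl⟩
    obtain ⟨oa, hoa⟩ := hop a ha
    obtain ⟨ob, hob⟩ := hop b hb
    obtain ⟨Is, ws, hl, hrun, hout⟩ := ih (vs ++ [v]) (by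
      rintro w (rfl | hw)
      · exact ⟨.reg vs.length, fun x => by simp [Operand.eval]⟩
      · obtain ⟨o, ho⟩ := hA w hw
        refine ⟨o, fun x => ?_⟩
        rw [← ho x]
        cases o with
        | input i => rfl
        | const c => rfl
        | reg k =>
          have := ho x
          simp only [Operand.eval] at this ⊢
          rw [List.map_append, List.getElem?_append_left]
          exact (List.getElem?_eq_some_iff.1 this).1)
    refine ⟨⟨op, oa, ob⟩ :: Is, ws, by simpa using hl, fun x => ?_, hout⟩
    simp only [runInstrs, hoa, hob, hv, Option.bind_some]
    simpa using hrun x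

/-- A derivation from the inputs is a program. -/
theorem Computes.exists_slp {ι o : Type*} {t : ℝ} {B : Set ((ι → F) → F)}
    (h : Computes S (Set.range fun (i : ι) (x : ι → F) => x i) B t)
    (y : o → (ι → F) → F) (hy : ∀ j, y j ∈ B) :
    ∃ P : SLP S ι o, (P.cost : ℝ) ≤ t ∧ ∀ x, P.Outputs x fun j => y j x := by
  obtain ⟨n, hn, h⟩ := h
  obtain ⟨Is, ws, hl, hrun, hout⟩ := h.exists_instrs [] (by
    rintro _ ⟨i, rfl⟩
    exact ⟨.input i, fun x => rfl⟩)
  choose out hout using fun j => hout (y j) (hy j)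
  refine ⟨⟨Is, out⟩, ?_, fun x => ⟨_, by simpa using hrun x, fun j => hout j x⟩⟩
  exact le_trans (by exact_mod_cast hl) hn

/-- Nonemptiness of `Ω` ensures that the registers used by a program that does not fail exist. -/
theorem derives_of_runInstrs [Nonempty Ω] {ι o : Type*} (g : ι → Ω → F) (out : o → Operand S ι)
    (y : o → Ω → F) (Is : List (Instr S ι)) (vs : List (Ω → F))
    (h : ∀ x, ∃ mem, runInstrs (fun i => g i x) Is (vs.map fun v => v x) = some mem ∧
      ∀ j, (out j).eval (fun i => g i x) mem = some (y j x)) :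
    Derives S (Set.range g ∪ {v | v ∈ vs}) (Set.range y) Is.length := by
  have hop : ∀ (op : Operand S ι), (∀ x, ∃ a, op.eval (fun i => g i x) (vs.map fun v => v x)
      = some a) → ∃ a ∈ (Set.range g ∪ {v | v ∈ vs}) ∪ consts S Ω,
        ∀ x, op.eval (fun i => g i x) (vs.map fun v => v x) = some (a x) := by
    intro op hop
    cases op with
    | input i => exact ⟨g i, .inl (.inl ⟨i, rfl⟩), fun x => rfl⟩
    | const c => exact ⟨fun _ => c, .inr ⟨c, rfl⟩, fun x => rfl⟩
    | reg k =>
      have hk : k < vs.length := by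
        obtain ⟨a, ha⟩ := hop (Classical.arbitrary Ω)
        simpa using (List.getElem?_eq_some_iff.1 ha).1
      exact ⟨vs[k], .inl (.inr (List.getElem_mem hk)), fun x => by simp [Operand.eval, hk]⟩
  induction Is generalizing vs with
  | nil =>
    refine .done _ ?_
    rintro _ ⟨j, rfl⟩
    simp only [runInstrs, Option.some.injEq, exists_eq_left'] at h
    obtain ⟨a, ha, h'⟩ := hop (out j) fun x => ⟨_, h x j⟩
    convert ha using 1
    funext x
    exact Option.some.inj ((h x j).symm.trans (h' x))
  | cons I Is ih =>
    have h2 : ∀ x, ∃ a b v, I.left.eval (fun i => g i x) (vs.map fun v => v x) = some a ∧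
        I.right.eval (fun i => g i x) (vs.map fun v => v x) = some b ∧
        I.op.eval a b = some v ∧ ∃ mem, runInstrs (fun i => g i x) Is
          ((vs.map fun v => v x) ++ [v]) = some mem ∧
            ∀ j, (out j).eval (fun i => g i x) mem = some (y j x) := by
      intro x
      obtain ⟨mem, h1, h2⟩ := h x
      simp only [runInstrs, Option.bind_eq_some_iff] at h1
      obtain ⟨a, ha, b, hb, v, hv, h1⟩ := h1
      exact ⟨a, b, v, ha, hb, hv, mem, h1, h2⟩
    choose a b v ha hb hv hmem using h2
    obtain ⟨a', ha', ha2⟩ := hop I.left fun x => ⟨_, ha x⟩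
    obtain ⟨b', hb', hb2⟩ := hop I.right fun x => ⟨_, hb x⟩
    obtain rfl : a' = a := funext fun x => Option.some.inj ((ha2 x).symm.trans (ha x))
    obtain rfl : b' = b := funext fun x => Option.some.inj ((hb2 x).symm.trans (hb x))
    refine .step I.op a' b' v ha' hb' hv ((ih (vs ++ [v]) ?_ ?_).mono ?_ subset_rfl)
    · intro x
      simpa using hmem x
    · intro op hop'
      cases op with
      | input i => exact ⟨g i, .inl (.inl ⟨i, rfl⟩), fun x => rfl⟩
      | const c => exact ⟨fun _ => c, .inr ⟨c, rfl⟩, fun x => rfl⟩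
      | reg k =>
        have hk : k < (vs ++ [v]).length := by
          obtain ⟨a, ha⟩ := hop' (Classical.arbitrary Ω)
          simpa using (List.getElem?_eq_some_iff.1 ha).1
        refine ⟨(vs ++ [v])[k], .inl (.inr (List.getElem_mem hk)), fun x => ?_⟩
        simp only [Operand.eval, List.getElem?_map, List.getElem?_eq_getElem hk, Option.map_some]
    · rintro w (hw | hw)
      · exact .inr (.inl hw)
      · simp only [List.mem_append, List.mem_singleton, Set.mem_ofPred_eq] at hw
        rcases hw with hw | rfl
        · exact .inr (.inr hw)
        · exact .inl rfl

/-- A program, applied to values `g` that are available. -/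
theorem _root_.SLP.computes [Nonempty Ω] {ι o : Type*} {t : ℝ} (P : SLP S ι o)
    (hP : (P.cost : ℝ) ≤ t) (g : ι → Ω → F) (y : o → Ω → F)
    (h : ∀ x, P.Outputs (fun i => g i x) fun j => y j x) :
    Computes S (Set.range g) (Set.range y) t := by
  refine ⟨P.cost, hP, ?_⟩
  have := derives_of_runInstrs g P.outputs y P.instrs [] (fun x => by simpa [SLP.Outputs] using h x)
  exact this.mono (by simp) subset_rfl

end Framework

/-! ### Convolutions -/

section Segments

variable {F : Type*} {Ω : Type*}

/-- The set of the first `n` values of a sequence. -/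
def seg (n : ℕ) (f : ℕ → Ω → F) : Set (Ω → F) :=
  f '' Set.Iio n

theorem mem_seg {n i : ℕ} (f : ℕ → Ω → F) (h : i < n) : f i ∈ seg n f :=
  ⟨i, h, rfl⟩

theorem seg_mono {n m : ℕ} (f : ℕ → Ω → F) (h : n ≤ m) : seg n f ⊆ seg m f :=
  Set.image_mono (Set.Iio_subset_Iio h)

theorem seg_subset {n : ℕ} {f : ℕ → Ω → F} {A : Set (Ω → F)} (h : ∀ i < n, f i ∈ A) :
    seg n f ⊆ A := by
  rintro _ ⟨i, hi, rfl⟩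
  exact h i hi

theorem seg_congr {n : ℕ} {f g : ℕ → Ω → F} (h : ∀ i < n, f i = g i) : seg n f = seg n g :=
  Set.image_congr h

theorem seg_reverse_subset (n : ℕ) (f : ℕ → Ω → F) :
    seg n (fun i => f (n - 1 - i)) ⊆ seg n f :=
  seg_subset fun i hi => mem_seg f (by omega)

end Segments

section Convolution

variable {F : Type*} [Field F] {Ω : Type*} {S : Set F}

theorem Computes.seg {n : ℕ} {f : ℕ → Ω → F} {A : Set (Ω → F)} {t : ℝ}
    (h : ∀ i < n, Computes S A {f i} t) : Computes S A (seg n f) (n * t) := by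
  refine (Computes.biUnion_lt h).right ?_
  rintro _ ⟨i, hi, rfl⟩
  simp only [Set.mem_iUnion, Finset.mem_range]
  exact ⟨i, hi, rfl⟩

theorem Computes.seg_free {n : ℕ} {f : ℕ → Ω → F} {A : Set (Ω → F)}
    (h : ∀ i < n, Computes S A {f i} 0) : Computes S A (OpMul.seg n f) 0 := by
  simpa using Computes.seg h

/-- Computation of a recursively defined sequence. -/
theorem Computes.seg_rec {n : ℕ} {f : ℕ → Ω → F} {A : Set (Ω → F)} {t : ℝ}
    (h : ∀ i < n, Computes S (A ∪ OpMul.seg i f) {f i} t) :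
    Computes S A (OpMul.seg n f) (n * t) := by
  refine (Computes.accumulate (B := fun i => {f i}) (fun i hi => (h i hi).left ?_)).right ?_
  · refine Set.union_subset_union_right _ (seg_subset fun j hj => ?_)
    simp only [Set.mem_iUnion, Finset.mem_range]
    exact ⟨j, hj, rfl⟩
  · refine seg_subset fun j hj => ?_
    simp only [Set.mem_iUnion, Finset.mem_range]
    exact ⟨j, hj, rfl⟩

/-- The polynomial with the coefficients `f 0, …, f (n - 1)`. -/
noncomputable def poly (n : ℕ) (f : ℕ → F) : F[X] :=
  ∑ i ∈ Finset.range n, C (f i) * X ^ i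

theorem poly_coeff (n : ℕ) (f : ℕ → F) (k : ℕ) :
    (poly n f).coeff k = if k < n then f k else 0 := by
  simp [poly, coeff_C_mul, coeff_X_pow]

theorem poly_degree_lt (n : ℕ) (f : ℕ → F) : (poly n f).degree < n := by
  rw [degree_lt_iff_coeff_zero]
  intro m hm
  rw [poly_coeff, if_neg (by omega)]

theorem poly_add (n : ℕ) (f : ℕ → F) :
    poly (n + n) f = poly n f + X ^ n * poly n (fun i => f (n + i)) := by
  simp only [poly, Finset.sum_range_add, Finset.mul_sum]
  congr 1
  refine Finset.sum_congr rfl fun i _ => ?_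
  ring

theorem poly_of_degree_lt {n : ℕ} {p : F[X]} (h : p.degree < n) : poly n p.coeff = p := by
  ext k
  rw [poly_coeff]
  split_ifs with hk
  · rfl
  · exact ((degree_lt_iff_coeff_zero _ _).1 h k (by omega)).symm

theorem poly_mul_coeff_eq_zero (n : ℕ) (f g : ℕ → F) {k : ℕ} (hk : 2 * n ≤ k) :
    (poly n f * poly n g).coeff k = 0 := by
  rw [coeff_mul]
  refine Finset.sum_eq_zero fun ij hij => ?_
  rw [Finset.HasAntidiagonal.mem_antidiagonal] at hij
  rw [poly_coeff, poly_coeff]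
  by_cases h : ij.1 < n
  · rw [if_neg (show ¬ ij.2 < n by omega), mul_zero]
  · rw [if_neg h, zero_mul]

/-- All coefficients of the product of two polynomials of degree less than `n` can be computed with
at most `T` operations. -/
def ProductBound (S : Set F) (Ω : Type*) (n : ℕ) (T : ℝ) : Prop :=
  ∀ f g : ℕ → Ω → F, Computes S (seg n f ∪ seg n g)
    (seg (2 * n) fun k x => (poly n (fun i => f i x) * poly n (fun i => g i x)).coeff k) T

theorem productBound_of_polynomialsMulWithin [Nonempty Ω] {n : ℕ} {T : ℝ}
    (h : PolynomialsMulWithin S n T) : ProductBound S Ω n T := by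
  obtain ⟨P, hc, hP⟩ := h
  intro f g
  refine (P.computes hc (Sum.elim (fun (i : Fin n) => f i) (fun (i : Fin n) => g i))
    (fun (k : Fin (2 * n)) x => (poly n (fun i => f i x) * poly n (fun i => g i x)).coeff k)
    fun x => ?_).mono ?_ ?_ le_rfl
  · have := hP (poly n fun i => f i x) (poly n fun i => g i x) (poly_degree_lt _ _)
      (poly_degree_lt _ _)
    simp only [poly_coeff] at this
    convert this using 2 with i
    rcases i with i | i <;> simp
  · rintro _ ⟨i | i, rfl⟩
    · exact .inl ⟨i, i.2, rfl⟩
    · exact .inr ⟨i, i.2, rfl⟩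
  · exact seg_subset fun i hi => ⟨⟨i, hi⟩, rfl⟩

theorem Computes.zero {A : Set (Ω → F)} (h0 : (0 : F) ∈ S) {v : Ω → F} (hv : ∀ x, v x = 0) :
    Computes S A {v} 0 := by
  obtain rfl : v = fun _ => 0 := funext hv
  exact .const h0

/-- Splitting both factors into two halves gives four products of half the size, and at most three
additions for each of the `4 * n` coefficients. -/
theorem ProductBound.double {n : ℕ} {T : ℝ} (h0 : (0 : F) ∈ S) (hT : (n : ℝ) ≤ T)
    (h : ProductBound S Ω n T) : ProductBound S Ω (2 * n) (16 * T) := by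
  intro f g
  let f' : ℕ → Ω → F := fun i => f (n + i)
  let g' : ℕ → Ω → F := fun i => g (n + i)
  let pr : (ℕ → Ω → F) → (ℕ → Ω → F) → ℕ → Ω → F := fun f g k x =>
    (poly n (fun i => f i x) * poly n (fun i => g i x)).coeff k
  have hcoe : ∀ (f g : ℕ → Ω → F) (A : Set (Ω → F)), seg (2 * n) (pr f g) ⊆ A →
      ∀ m k, Computes S A {fun x => (X ^ m * (poly n (fun i => f i x) *
        poly n (fun i => g i x))).coeff k} 0 := by
    intro f g A hA m k
    by_cases hm : m ≤ k
    · by_cases hk : k - m < 2 * n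
      · convert Computes.of_mem (S := S) (hA (mem_seg _ hk)) using 2
        funext x
        rw [coeff_X_pow_mul', if_pos hm]
      · refine .zero h0 fun x => ?_
        rw [coeff_X_pow_mul', if_pos hm, poly_mul_coeff_eq_zero _ _ _ (by omega)]
    · refine .zero h0 fun x => ?_
      rw [coeff_X_pow_mul', if_neg hm]
  have hb : Computes S (seg (2 * n) f ∪ seg (2 * n) g)
      ((seg (2 * n) (pr f g) ∪ seg (2 * n) (pr f g')) ∪
        (seg (2 * n) (pr f' g) ∪ seg (2 * n) (pr f' g'))) ((T + T) + (T + T)) := by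
    have hf : seg n f ⊆ seg (2 * n) f := seg_mono _ (by omega)
    have hg : seg n g ⊆ seg (2 * n) g := seg_mono _ (by omega)
    have hf' : seg n f' ⊆ seg (2 * n) f := seg_subset fun i hi => mem_seg f (by omega)
    have hg' : seg n g' ⊆ seg (2 * n) g := seg_subset fun i hi => mem_seg g (by omega)
    exact (((h f g).left (Set.union_subset_union hf hg)).union
      ((h f g').left (Set.union_subset_union hf hg'))).union
      (((h f' g).left (Set.union_subset_union hf' hg)).union
        ((h f' g').left (Set.union_subset_union hf' hg')))
  refine (hb.trans (Computes.seg (t := 3) fun k hk => ?_)).le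
    (t := 16 * T) (by push_cast; linarith)
  set A := seg (2 * n) f ∪ seg (2 * n) g ∪
      ((seg (2 * n) (pr f g) ∪ seg (2 * n) (pr f g')) ∪
        (seg (2 * n) (pr f' g) ∪ seg (2 * n) (pr f' g')))
  have h1 := hcoe f g A (fun v hv => .inr (.inl (.inl hv))) 0 k
  have h2 := hcoe f g' A (fun v hv => .inr (.inl (.inr hv))) n k
  have h3 := hcoe f' g A (fun v hv => .inr (.inr (.inl hv))) n k
  have h4 := hcoe f' g' A (fun v hv => .inr (.inr (.inr hv))) (n + n) k
  convert ((h1.add h2).add h3).add h4 using 2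
  · funext x
    simp only [two_mul, poly_add, ← coeff_add]
    congr 1
    ring
  · norm_num

/-- For all `n ≤ N`, the first `n` terms of a convolution of sequences can be computed with at
most `lam * n` operations from the first `n` terms of the factors. -/
def ConvBound (S : Set F) (Ω : Type*) (N : ℕ) (lam : ℝ) : Prop :=
  ∀ n ≤ N, ∀ f g h : ℕ → Ω → F,
    (∀ k < n, ∀ x, h k x = ∑ i ∈ Finset.range (k + 1), f i x * g (k - i) x) →
      Computes S (seg n f ∪ seg n g) (seg n h) (lam * n)

theorem ProductBound.conv {n m : ℕ} {T : ℝ} (h0 : (0 : F) ∈ S) (h : ProductBound S Ω m T)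
    (hnm : n ≤ m) (f g c : ℕ → Ω → F)
    (hc : ∀ k < n, ∀ x, c k x = ∑ i ∈ Finset.range (k + 1), f i x * g (k - i) x) :
    Computes S (seg n f ∪ seg n g) (seg n c) T := by
  let f' : ℕ → Ω → F := fun i x => if i < n then f i x else 0
  let g' : ℕ → Ω → F := fun i x => if i < n then g i x else 0
  have aux : ∀ (u : ℕ → Ω → F), Computes S (seg n u)
      (seg m (fun i x => if i < n then u i x else 0)) 0 := by
    intro u
    refine .seg_free fun i _ => ?_
    by_cases hi : i < n
    · simpa [hi] using Computes.of_mem (S := S) (mem_seg u hi)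
    · exact .zero h0 fun x => by simp [hi]
  have h1 := ((aux f).left Set.subset_union_left).union ((aux g).left Set.subset_union_right)
  refine (h1.trans ((h f' g').left Set.subset_union_right)).mono subset_rfl ?_ (by simp)
  refine (seg_congr fun k hk => ?_).trans_subset (seg_mono _ (by omega))
  funext x
  rw [hc k hk, coeff_mul, Finset.Nat.sum_antidiagonal_eq_sum_range_succ_mk]
  refine Finset.sum_congr rfl fun i hi => ?_
  rw [Finset.mem_range] at hi
  simp [poly_coeff, f', g', show i < n by omega, show k - i < n by omega,
    show i < m by omega, show k - i < m by omega]

/-- A product of two scalars is neither an input nor a constant. -/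
theorem one_le_of_polynomialsMulWithin_one {t : ℝ} (h : PolynomialsMulWithin S 1 t) : 1 ≤ t := by
  obtain ⟨P, hc, hP⟩ := h
  refine le_trans ?_ hc
  rw [Nat.one_le_cast, Nat.one_le_iff_ne_zero]
  intro h0
  have hI : P.instrs = [] := List.length_eq_zero_iff.1 h0
  have key : ∀ a b : F, (P.outputs 0).eval (Sum.elim (fun _ => a) (fun _ => b)) [] =
      some (a * b) := by
    intro a b
    obtain ⟨mem, hm, ho⟩ := hP (C a) (C b) (degree_C_le.trans_lt (by norm_num))
      (degree_C_le.trans_lt (by norm_num))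
    rw [hI] at hm
    obtain rfl : [] = mem := by simpa [runInstrs] using hm
    simpa using ho 0
  generalize P.outputs 0 = o at key
  cases o with
  | input i =>
    rcases i with i | i
    · simpa [Operand.eval] using key 1 0
    · simpa [Operand.eval] using key 0 1
  | const c =>
    have h1 := key 0 0
    have h2 := key 1 1
    rw [Operand.eval] at h1 h2
    rw [h1] at h2
    simp at h2
  | reg k => simpa [Operand.eval] using key 0 0

/-- Quasi-linearity at sizes up to `16 * r`, with the slope `M r / r`: blocks of size `r` reduce the
sizes above `r` to the size `r`. -/
theorem convBound_of_polynomialsMulWithin [Nonempty Ω] (h0 : (0 : F) ∈ S) {M : ℕ → ℝ}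
    (hM : ∀ n : ℕ, 1 ≤ n → PolynomialsMulWithin S n (M n))
    (hM_mono : MonotoneOn (fun n : ℕ => M n / (n : ℝ)) (Set.Ici 1)) {r : ℕ} (hr : 1 ≤ r) :
    1 ≤ M r / r ∧ ConvBound S Ω (16 * r) (65536 * (M r / r)) := by
  have hone : 1 ≤ M r / r := by
    have h1 := one_le_of_polynomialsMulWithin_one (hM 1 le_rfl)
    have h2 := hM_mono (Set.mem_Ici.2 le_rfl) (Set.mem_Ici.2 hr) hr
    simp only [Nat.cast_one, div_one] at h2
    exact h1.trans h2
  have hr' : (0 : ℝ) < r := by exact_mod_cast hr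
  refine ⟨hone, fun n hn f g c hc => ?_⟩
  rcases Nat.eq_zero_or_pos n with rfl | hn0
  · exact Computes.of_subset (seg_subset fun i hi => absurd hi (by omega)) (by simp)
  have hn' : (0 : ℝ) < n := by exact_mod_cast hn0
  rcases le_total n r with hnr | hnr
  · refine ((productBound_of_polynomialsMulWithin (hM n hn0)).conv h0 le_rfl f g c hc).le ?_
    have h2 := hM_mono (Set.mem_Ici.2 hn0) (Set.mem_Ici.2 hr) hnr
    simp only at h2
    rw [div_le_iff₀ hn'] at h2
    nlinarith
  · -- Four doublings lead from the length `r` to the length `16 * r`, and `16 ^ 4 = 65536`.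
    have hMr : (r : ℝ) ≤ M r := by rwa [one_le_div hr'] at hone
    have h2 := (((((productBound_of_polynomialsMulWithin (Ω := Ω) (hM r hr)).double h0 hMr).double
      h0 (by push_cast; linarith)).double h0 (by push_cast; linarith)).double h0
        (by push_cast; linarith)).conv h0 (n := n) (by omega) f g c hc
    refine h2.le ?_
    have h3 : M r ≤ M r / r * n := by
      rw [div_mul_eq_mul_div, le_div_iff₀ hr']
      exact mul_le_mul_of_nonneg_left (by exact_mod_cast hnr) (by linarith)
    linarith

end Convolution

/-! ### Moments, moduli and interpolation -/

section Moments

variable {F : Type*} [Field F]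

theorem taylor_coeff_eq_sum (c : F) {n : ℕ} {p : F[X]} (hp : p.degree < n) (l : ℕ) :
    (taylor c p).coeff l = ∑ i ∈ Finset.range n, p.coeff i * ((i.choose l : F) * c ^ (i - l)) := by
  conv_lhs => rw [← poly_of_degree_lt hp]
  simp only [poly, map_sum, finsetSum_coeff]
  refine Finset.sum_congr rfl fun i _ => ?_
  rw [taylor_mul, taylor_C, taylor_pow, taylor_X, coeff_C_mul, coeff_X_add_C_pow]
  ring

theorem taylor_degree_lt (c : F) {n : ℕ} {p : F[X]} (hp : p.degree < n) :
    (taylor c p).degree < n := by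
  rwa [degree_taylor]

/-- The leading part of the remainder of `q` modulo `G`: the coefficient of
`X ^ (G.natDegree - 1)`. -/
noncomputable def rho (G q : F[X]) : F :=
  (q %ₘ G).coeff (G.natDegree - 1)

theorem rho_add (G p q : F[X]) : rho G (p + q) = rho G p + rho G q := by
  simp [rho, add_modByMonic]

theorem rho_C_mul (G : F[X]) (c : F) (q : F[X]) : rho G (C c * q) = c * rho G q := by
  simp [rho, ← smul_eq_C_mul, smul_modByMonic]

theorem rho_sum (G : F[X]) {ι : Type*} (s : Finset ι) (f : ι → F[X]) :
    rho G (∑ i ∈ s, f i) = ∑ i ∈ s, rho G (f i) := by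
  classical
  induction s using Finset.induction_on with
  | empty => simp [rho]
  | insert a s ha ih => rw [Finset.sum_insert ha, Finset.sum_insert ha, rho_add, ih]

theorem rho_mul_eq_sum (G : F[X]) {n : ℕ} {p : F[X]} (hp : p.degree < n) (q : F[X]) :
    rho G (p * q) = ∑ l ∈ Finset.range n, p.coeff l * rho G (X ^ l * q) := by
  conv_lhs => rw [← poly_of_degree_lt hp]
  simp only [poly, Finset.sum_mul, rho_sum, mul_assoc, rho_C_mul]

/-- The remainder of `G₂ * q` modulo `G₁ * G₂` is `G₂` times the remainder of `q` modulo `G₁`. -/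
theorem rho_mul_left {G₁ G₂ : F[X]} (h₁ : G₁.Monic) (h₂ : G₂.Monic) (hd : 0 < G₁.natDegree)
    (q : F[X]) : rho (G₁ * G₂) (G₂ * q) = rho G₁ q := by
  have h0 : (q %ₘ G₁).degree < G₁.degree := degree_modByMonic_lt _ h₁
  have hmod : (G₂ * q) %ₘ (G₁ * G₂) = G₂ * (q %ₘ G₁) := by
    refine (div_modByMonic_unique (q /ₘ G₁) _ (h₁.mul h₂) ⟨?_, ?_⟩).2
    · conv_rhs => rw [← modByMonic_add_div q G₁]
      ring
    · rw [mul_comm, degree_mul, degree_mul]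
      exact WithBot.add_lt_add_right (by simp [h₂.ne_zero]) h0
  rw [rho, rho, hmod, h₁.natDegree_mul h₂,
    show G₁.natDegree + G₂.natDegree - 1 = G₂.natDegree + (G₁.natDegree - 1) by omega,
    coeff_mul_add_eq_of_natDegree_le le_rfl, h₂.coeff_natDegree, one_mul]
  have : G₁ ≠ 1 := by
    rintro rfl
    simp at hd
  have := natDegree_modByMonic_lt q h₁ this
  omega

theorem rho_taylor {G : F[X]} (hG : G.Monic) (hd : 0 < G.natDegree) (c : F) (q : F[X]) :
    rho (taylor c G) (taylor c q) = rho G q := by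
  have hG' : (taylor c G).Monic := by
    rw [Monic, leadingCoeff_taylor]
    exact hG
  have hmod : taylor c q %ₘ taylor c G = taylor c (q %ₘ G) := by
    refine (div_modByMonic_unique (taylor c (q /ₘ G)) _ hG' ⟨?_, ?_⟩).2
    · rw [← taylor_mul, ← map_add, modByMonic_add_div q G]
    · rw [degree_taylor, degree_taylor]
      exact degree_modByMonic_lt _ hG
  have hlt : (q %ₘ G).degree < ((G.natDegree - 1 + 1 : ℕ) : WithBot ℕ) := by
    refine (degree_modByMonic_lt _ hG).trans_le (degree_le_natDegree.trans ?_)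
    exact_mod_cast (by omega)
  rw [rho, rho, hmod, natDegree_taylor, taylor_coeff_eq_sum c hlt, Finset.sum_range_succ,
    Finset.sum_eq_zero]
  · simp
  · intro i hi
    rw [Nat.choose_eq_zero_of_lt (Finset.mem_range.1 hi)]
    simp

theorem rho_of_degree_lt {G q : F[X]} (hG : G.Monic) (h : q.degree < G.degree) :
    rho G q = q.coeff (G.natDegree - 1) := by
  rw [rho, (modByMonic_eq_self_iff hG).2 h]

theorem rho_dvd {G q : F[X]} (hG : G.Monic) (h : G ∣ q) : rho G q = 0 := by
  rw [rho, (modByMonic_eq_zero_iff_dvd hG).2 h]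
  simp

theorem rho_X_pow {e i : ℕ} (hi : i < e) (q : F[X]) :
    rho (X ^ e) (X ^ i * q) = q.coeff (e - 1 - i) := by
  have h := congrArg (fun p => coeff p (e - 1)) (modByMonic_add_div (X ^ i * q) (X ^ e))
  simp only [coeff_add, coeff_X_pow_mul', if_neg (show ¬ e ≤ e - 1 by omega), add_zero,
    if_pos (show i ≤ e - 1 by omega)] at h
  rw [rho, natDegree_X_pow, h]


/-- The coefficients of `G` from the leading one downwards. -/
noncomputable def revCoeff (G : F[X]) (u : ℕ) : F :=
  if u ≤ G.natDegree then G.coeff (G.natDegree - u) else 0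

/-- The coefficients of the expansion of `X ^ G.natDegree / G` in powers of `X⁻¹`. -/
noncomputable def infInv (G : F[X]) (u : ℕ) : F :=
  rho G (X ^ (G.natDegree - 1 + u))

theorem rho_X_pow_of_lt {G : F[X]} (hG : G.Monic) {i : ℕ} (hi : i < G.natDegree) :
    rho G (X ^ i) = if i = G.natDegree - 1 then 1 else 0 := by
  rw [rho_of_degree_lt hG, coeff_X_pow]
  · simp only [eq_comm]
  · rw [degree_X_pow, degree_eq_natDegree hG.ne_zero]
    exact_mod_cast hi

/-- The sequence `infInv G` is the inverse of the reversal of `G`: the vanishing of `rho G` on the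
multiples `G * X ^ t` is the recurrence that expresses this. -/
theorem sum_revCoeff_mul_infInv {G : F[X]} (hG : G.Monic) (hd : 0 < G.natDegree) (t : ℕ) :
    ∑ s ∈ Finset.range (t + 1), revCoeff G s * infInv G (t - s) = if t = 0 then 1 else 0 := by
  set D := G.natDegree with hD
  rcases t with _ | t
  · simp [revCoeff, infInv, ← hD, rho_X_pow_of_lt hG (show D - 1 < D by omega)]
    exact hG.coeff_natDegree
  rw [if_neg (by omega)]
  let g : ℕ → F := fun s => revCoeff G s * (if s ≤ t + 1 then infInv G (t + 1 - s) else 0)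
  have h1 : ∑ s ∈ Finset.range (t + 1 + 1), revCoeff G s * infInv G (t + 1 - s) =
      ∑ s ∈ Finset.range (D + t + 2), g s := by
    rw [← Finset.sum_subset (Finset.range_subset_range.2 (show t + 1 + 1 ≤ D + t + 2 by omega))]
    · refine Finset.sum_congr rfl fun s hs => ?_
      rw [Finset.mem_range] at hs
      simp only [g]
      rw [if_pos (by omega)]
    · intro s _ hs
      rw [Finset.mem_range] at hs
      simp only [g]
      rw [if_neg (by omega), mul_zero]
  have h2 : ∑ s ∈ Finset.range (D + 1), g s = ∑ s ∈ Finset.range (D + t + 2), g s := by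
    refine Finset.sum_subset (Finset.range_subset_range.2 (by omega)) ?_
    intro s _ hs
    rw [Finset.mem_range] at hs
    simp only [g, revCoeff]
    rw [if_neg (by omega), zero_mul]
  have h3 : rho G (G * X ^ t) = 0 := rho_dvd hG (dvd_mul_right _ _)
  rw [rho_mul_eq_sum G (n := D + 1) (degree_le_natDegree.trans_lt (by
    exact_mod_cast Nat.lt_succ_self _)), ← Finset.sum_range_reflect] at h3
  rw [h1, ← h2, ← h3]
  refine Finset.sum_congr rfl fun s hs => ?_
  rw [Finset.mem_range] at hs
  simp only [g, revCoeff, ← hD]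
  rw [if_pos (by omega), ← pow_add, show D + 1 - 1 - s = D - s by omega]
  congr 1
  split_ifs with h
  · rw [infInv, ← hD]
    congr 2
    omega
  · rw [rho_X_pow_of_lt hG (by omega), if_neg (by omega)]

/-- The first moments of `q` modulo `G`, from the expansion of `1 / G` at infinity. -/
theorem rho_X_pow_mul_eq_sum {G q : F[X]} (hG : G.Monic) (hq : q.degree < G.natDegree)
    {i : ℕ} (hi : i < G.natDegree) :
    rho G (X ^ i * q) =
      ∑ s ∈ Finset.range (i + 1), q.coeff (G.natDegree - 1 - s) * infInv G (i - s) := by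
  set D := G.natDegree with hD
  rw [mul_comm, rho_mul_eq_sum G hq, ← Finset.sum_range_reflect]
  symm
  have hsub : Finset.range (i + 1) ⊆ Finset.range D :=
    Finset.range_subset_range.2 (by omega)
  rw [← Finset.sum_subset hsub]
  · refine Finset.sum_congr rfl fun s hs => ?_
    rw [Finset.mem_range] at hs
    rw [infInv, ← hD, ← pow_add]
    congr 3
    omega
  · intro s hs hs'
    rw [Finset.mem_range] at hs hs'
    rw [← pow_add, rho_X_pow_of_lt hG (by omega), if_neg (by omega), mul_zero]

/-- The modulus `∏ (X - k) ^ e` over `k < m`, for expansions to the order `e` at the points `k`. -/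
noncomputable def nodal (F : Type*) [Field F] (e m : ℕ) : F[X] :=
  ∏ k ∈ Finset.range m, (X - C (k : F)) ^ e

theorem nodal_monic (e m : ℕ) : (nodal F e m).Monic :=
  monic_prod_of_monic _ _ fun _ _ => (monic_X_sub_C _).pow e

theorem nodal_natDegree (e m : ℕ) : (nodal F e m).natDegree = e * m := by
  rw [nodal, natDegree_prod_of_monic _ _ fun _ _ => (monic_X_sub_C _).pow e]
  have h (k : ℕ) : ((X : F[X]) - (k : F[X])).natDegree = 1 := by
    simpa using natDegree_X_sub_C (k : F)
  simp [natDegree_pow, h, mul_comm]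

theorem taylor_prod {ι : Type*} (c : F) (s : Finset ι) (f : ι → F[X]) :
    taylor c (∏ i ∈ s, f i) = ∏ i ∈ s, taylor c (f i) :=
  map_prod (taylorAlgHom c) f s

theorem nodal_add (e m n : ℕ) :
    nodal F e (m + n) = nodal F e m * taylor (-(m : F)) (nodal F e n) := by
  simp only [nodal, Finset.prod_range_add, taylor_prod]
  congr 1
  refine Finset.prod_congr rfl fun k _ => ?_
  rw [taylor_pow, map_sub, taylor_X, taylor_C]
  push_cast
  simp only [map_add, map_neg]
  ring

theorem nodal_one (e : ℕ) : nodal F e 1 = X ^ e := by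
  simp [nodal]

/-- The moments of `q` modulo `nodal F e m`: the coefficients of `X ^ (-1 - i)` in the expansion of
`q / nodal F e m` at infinity. -/
noncomputable def mom (e m : ℕ) (q : F[X]) (i : ℕ) : F :=
  rho (nodal F e m) (X ^ i * q)

/-- The moments of `q` modulo the translate by `m` of `nodal F e m`. -/
noncomputable def momShift (e m : ℕ) (q : F[X]) (i : ℕ) : F :=
  rho (taylor (-(m : F)) (nodal F e m)) (X ^ i * q)

theorem nodal_degree_lt (e m : ℕ) : (nodal F e m).degree < ((e * m + 1 : ℕ) : WithBot ℕ) := by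
  refine degree_le_natDegree.trans_lt ?_
  rw [nodal_natDegree]
  exact_mod_cast Nat.lt_succ_self _

theorem nodal_taylor_monic (e m : ℕ) (c : F) : (taylor c (nodal F e m)).Monic := by
  rw [Monic, leadingCoeff_taylor]
  exact nodal_monic e m

/-- The moments for the first half of the points, from those for all `m + m` points. -/
theorem mom_eq_sum {e m : ℕ} (he : 0 < e) (hm : 0 < m) (q : F[X]) (i : ℕ) :
    mom e m q i = ∑ l ∈ Finset.range (e * m + 1),
      (taylor (-(m : F)) (nodal F e m)).coeff l * mom e (m + m) q (i + l) := by
  have hd : 0 < (nodal F e m).natDegree := by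
    rw [nodal_natDegree]
    positivity
  rw [mom, ← rho_mul_left (nodal_monic e m) (nodal_taylor_monic e m (-(m : F))) hd, ← nodal_add,
    rho_mul_eq_sum _ (taylor_degree_lt _ (nodal_degree_lt e m))]
  refine Finset.sum_congr rfl fun l _ => ?_
  rw [mom, ← mul_assoc, ← pow_add, add_comm l i]

/-- The moments for the second half of the points, from those for all `m + m` points. -/
theorem momShift_eq_sum {e m : ℕ} (he : 0 < e) (hm : 0 < m) (q : F[X]) (i : ℕ) :
    momShift e m q i = ∑ l ∈ Finset.range (e * m + 1),
      (nodal F e m).coeff l * mom e (m + m) q (i + l) := by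
  have hd : 0 < (taylor (-(m : F)) (nodal F e m)).natDegree := by
    rw [natDegree_taylor, nodal_natDegree]
    positivity
  rw [momShift, ← rho_mul_left (nodal_taylor_monic e m (-(m : F))) (nodal_monic e m) hd,
    mul_comm (taylor _ _) (nodal F e m), ← nodal_add, rho_mul_eq_sum _ (nodal_degree_lt e m)]
  refine Finset.sum_congr rfl fun l _ => ?_
  rw [mom, ← mul_assoc, ← pow_add, add_comm l i]

/-- Translation of the second half of the points to the first half. -/
theorem mom_taylor {e m : ℕ} (he : 0 < e) (hm : 0 < m) (q : F[X]) (i : ℕ) :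
    mom e m (taylor (m : F) q) i = ∑ l ∈ Finset.range (i + 1),
      momShift e m q l * ((i.choose l : F) * (-(m : F)) ^ (i - l)) := by
  have hd : 0 < (nodal F e m).natDegree := by
    rw [nodal_natDegree]
    positivity
  rw [mom, ← rho_taylor (nodal_monic e m) hd (-(m : F)), taylor_mul, taylor_taylor,
    neg_add_cancel, taylor_zero, taylor_pow, taylor_X]
  rw [rho_mul_eq_sum (n := i + 1)]
  · refine Finset.sum_congr rfl fun l _ => ?_
    rw [coeff_X_add_C_pow, momShift]
    ring
  · refine (degree_pow_le _ _).trans_lt ?_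
    rw [degree_X_add_C]
    simp only [nsmul_eq_mul, mul_one]
    exact_mod_cast Nat.lt_succ_self i

/-- For the single point `0`, the moments are the low coefficients, in reverse order. -/
theorem mom_one {e i : ℕ} (hi : i < e) (q : F[X]) : mom e 1 q i = q.coeff (e - 1 - i) := by
  rw [mom, nodal_one, rho_X_pow hi]

end Moments

section Newton

variable {F : Type*} [Field F]

/-- Newton iteration for the inverse of a power series with constant coefficient `1`. -/
noncomputable def newtonInv (f : PowerSeries F) : ℕ → PowerSeries F
  | 0 => 1
  | s + 1 => newtonInv f s * (2 - f * newtonInv f s)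

/-- Each step of the iteration squares the error `1 - f * newtonInv f s`. -/
theorem mul_newtonInv (f : PowerSeries F) (s : ℕ) : f * newtonInv f s = 1 - (1 - f) ^ (2 ^ s) := by
  induction s with
  | zero => simp [newtonInv]
  | succ s ih =>
    rw [newtonInv, ← mul_assoc, ih, pow_succ 2 s, pow_mul]
    ring

theorem coeff_newtonInv {f h : PowerSeries F} (hf : PowerSeries.constantCoeff f = 1) (hfh : f * h = 1)
    {s u : ℕ} (hu : u < 2 ^ s) :
    PowerSeries.coeff u (newtonInv f s) = PowerSeries.coeff u h := by
  have h1 : h - newtonInv f s = h * (1 - f) ^ (2 ^ s) := by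
    linear_combination (newtonInv f s) * hfh - h * mul_newtonInv f s
  have h2 : PowerSeries.X ^ (2 ^ s) ∣ h - newtonInv f s := by
    rw [h1]
    refine Dvd.dvd.mul_left (pow_dvd_pow_of_dvd ?_ _) _
    rw [PowerSeries.X_dvd_iff]
    simp [hf]
  have h3 := PowerSeries.X_pow_dvd_iff.1 h2 u hu
  rw [map_sub, sub_eq_zero] at h3
  exact h3.symm

end Newton

section Interpolation

variable {F : Type*} [Field F]

/-- The combination of the local data `c 0, …, c (2 ^ j - 1)`: the sum over `k` of the products of
the translate of `c k` to the point `k` and of the powers `(X - k') ^ e` with `k' ≠ k`. -/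
noncomputable def comb (e : ℕ) : ℕ → (ℕ → F[X]) → F[X]
  | 0, c => c 0
  | j + 1, c =>
    comb e j c * taylor (-((2 ^ j : ℕ) : F)) (nodal F e (2 ^ j)) +
      taylor (-((2 ^ j : ℕ) : F)) (comb e j fun k => c (2 ^ j + k)) * nodal F e (2 ^ j)

theorem comb_degree_lt {e : ℕ} {j : ℕ} {c : ℕ → F[X]} (hc : ∀ k, (c k).degree < e) :
    (comb e j c).degree < ((e * 2 ^ j : ℕ) : WithBot ℕ) := by
  induction j generalizing c with
  | zero => simpa [comb] using hc 0
  | succ j ih =>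
    have hn : (nodal F e (2 ^ j)).degree = ((e * 2 ^ j : ℕ) : WithBot ℕ) := by
      rw [degree_eq_natDegree (nodal_monic _ _).ne_zero, nodal_natDegree]
    have key : ∀ p q : F[X], p.degree < ((e * 2 ^ j : ℕ) : WithBot ℕ) →
        q.degree = ((e * 2 ^ j : ℕ) : WithBot ℕ) →
        (p * q).degree < ((e * 2 ^ (j + 1) : ℕ) : WithBot ℕ) := by
      intro p q hp hq
      rw [degree_mul, hq, pow_succ, ← mul_assoc, mul_two, Nat.cast_add (e * 2 ^ j)]
      exact WithBot.add_lt_add_right (WithBot.natCast_ne_bot _) hp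
    rw [comb]
    refine (degree_add_le _ _).trans_lt (max_lt (key _ _ (ih hc) ?_) (key _ _ ?_ hn))
    · rw [degree_taylor, hn]
    · rw [degree_taylor]
      exact ih fun k => hc _

/-- The expansion at the point `k` of the product of the `(X - k') ^ e` with `k' ≠ k`, `k' < m`. -/
noncomputable def cofactor (F : Type*) [Field F] (e m k : ℕ) : F[X] :=
  (∏ i ∈ Finset.range k, (X + C ((i + 1 : ℕ) : F)) ^ e) *
    ∏ i ∈ Finset.range (m - 1 - k), (X - C ((i + 1 : ℕ) : F)) ^ e

theorem taylor_nodal (c : F) (e m : ℕ) :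
    taylor c (nodal F e m) = ∏ i ∈ Finset.range m, (X + C (c - i)) ^ e := by
  rw [nodal, taylor_prod]
  refine Finset.prod_congr rfl fun i _ => ?_
  rw [taylor_pow, map_sub, taylor_X, taylor_C, C_sub]
  ring

theorem cofactor_add_right (e : ℕ) {m n k : ℕ} (hk : k < m) :
    cofactor F e (m + n) k =
      cofactor F e m k * taylor ((k : F) - m) (nodal F e n) := by
  rw [cofactor, cofactor, show m + n - 1 - k = (m - 1 - k) + n by omega, Finset.prod_range_add,
    taylor_nodal, mul_assoc]
  congr 2
  refine Finset.prod_congr rfl fun i _ => ?_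
  congr 1
  rw [show m - 1 - k + i + 1 = m + i - k by omega, Nat.cast_sub (by omega), sub_eq_add_neg, ← C_neg]
  push_cast
  congr 2
  ring

theorem cofactor_add_left (e : ℕ) {m n k : ℕ} (hk : k < n) :
    cofactor F e (m + n) (m + k) =
      cofactor F e n k * taylor ((m + k : ℕ) : F) (nodal F e m) := by
  rw [cofactor, cofactor, show m + n - 1 - (m + k) = n - 1 - k by omega, add_comm m k,
    Finset.prod_range_add, taylor_nodal, ← Finset.prod_range_reflect (fun i => (X + C (((k + m : ℕ) : F) - i)) ^ e) m]
  rw [mul_right_comm]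
  refine congrArg₂ _ rfl (Finset.prod_congr rfl fun i hi => ?_)
  rw [Finset.mem_range] at hi
  congr 3
  rw [eq_sub_iff_add_eq, ← Nat.cast_add]
  congr 1
  omega

theorem X_pow_dvd_taylor_nodal (e : ℕ) {m k : ℕ} (hk : k < m) :
    X ^ e ∣ taylor (k : F) (nodal F e m) := by
  rw [taylor_nodal]
  refine Dvd.dvd.trans ?_ (Finset.dvd_prod_of_mem _ (Finset.mem_range.2 hk))
  simp

/-- At the point `k < 2 ^ j` all terms of `comb e j c` but the one with index `k` vanish to the
order `e`. -/
theorem comb_taylor (e j : ℕ) (c : ℕ → F[X]) {k : ℕ} (hk : k < 2 ^ j) :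
    X ^ e ∣ taylor (k : F) (comb e j c) - c k * cofactor F e (2 ^ j) k := by
  induction j generalizing c k with
  | zero =>
    obtain rfl : k = 0 := by simpa using hk
    simp [comb, cofactor]
  | succ j ih =>
    rw [comb, map_add, taylor_mul, taylor_mul, taylor_taylor, taylor_taylor]
    rw [show (2 : ℕ) ^ (j + 1) = 2 ^ j + 2 ^ j by ring] at hk ⊢
    rcases lt_or_ge k (2 ^ j) with h | h
    · rw [cofactor_add_right e h, ← sub_eq_add_neg]
      obtain ⟨a, ha⟩ := ih c h
      obtain ⟨b, hb⟩ := X_pow_dvd_taylor_nodal (F := F) e h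
      rw [sub_eq_iff_eq_add] at ha
      rw [ha, hb]
      refine ⟨a * taylor (((k : F)) - ((2 ^ j : ℕ) : F)) (nodal F e (2 ^ j)) +
        taylor (((k : F)) - ((2 ^ j : ℕ) : F)) (comb e j fun k => c (2 ^ j + k)) * b, ?_⟩
      ring
    · obtain ⟨i, rfl⟩ : ∃ i, k = 2 ^ j + i := ⟨k - 2 ^ j, by omega⟩
      have hi : i < 2 ^ j := by omega
      rw [cofactor_add_left e hi, show ((2 ^ j + i : ℕ) : F) + -((2 ^ j : ℕ) : F) = (i : F) by
        push_cast; ring]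
      obtain ⟨a, ha⟩ := ih (fun k => c (2 ^ j + k)) hi
      obtain ⟨b, hb⟩ := X_pow_dvd_taylor_nodal (F := F) e hi
      rw [sub_eq_iff_eq_add] at ha
      rw [ha, hb]
      refine ⟨a * taylor ((2 ^ j + i : ℕ) : F) (nodal F e (2 ^ j)) +
        taylor ((2 ^ j + i : ℕ) : F) (comb e j c) * b, ?_⟩
      ring

/-- Uniqueness of Hermite interpolation; in characteristic zero the points `k < m` are distinct. -/
theorem eq_of_forall_taylor [CharZero F] {e m : ℕ} {p q : F[X]}
    (hp : p.degree < ((e * m : ℕ) : WithBot ℕ)) (hq : q.degree < ((e * m : ℕ) : WithBot ℕ))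
    (h : ∀ k < m, X ^ e ∣ taylor (k : F) p - taylor (k : F) q) : p = q := by
  have hdvd : nodal F e m ∣ p - q := by
    refine Finset.prod_dvd_of_coprime (fun a _ b _ hab => ?_) fun k hk => ?_
    · exact (pairwise_coprime_X_sub_C (s := fun k : ℕ => (k : F)) Nat.cast_injective hab).pow
    · obtain ⟨a, ha⟩ := h k (Finset.mem_range.1 hk)
      refine ⟨taylor (-(k : F)) a, taylor_injective (k : F) ?_⟩
      rw [map_sub, ha, taylor_mul, taylor_pow, map_sub, taylor_X, taylor_C, taylor_taylor,
        add_neg_cancel, taylor_zero, add_sub_cancel_right]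
  rw [← sub_eq_zero]
  refine eq_zero_of_dvd_of_degree_lt hdvd ?_
  rw [degree_eq_natDegree (nodal_monic _ _).ne_zero, nodal_natDegree]
  exact (degree_sub_le _ _).trans_lt (max_lt hp hq)

end Interpolation

/-! ### Elementary computations on coefficients -/

section Tools

variable {F : Type*} [Field F] {Ω : Type*} {S : Set F}

/-- The coefficient sequence of a polynomial. -/
noncomputable def cf (p : Ω → F[X]) : ℕ → Ω → F := fun i x => (p x).coeff i

/-- The coefficient sequence of a power series. -/
noncomputable def scf (f : Ω → PowerSeries F) : ℕ → Ω → F := fun i x => PowerSeries.coeff i (f x)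

/-- The sequence `0, 1, 2, …` of constants. -/
def natSeq (F Ω : Type*) [Field F] : ℕ → Ω → F := fun i _ => (i : F)

/-- The sequence of factorials. -/
def factSeq (F Ω : Type*) [Field F] : ℕ → Ω → F := fun i _ => (i.factorial : F)

/-- The coefficients `c ^ i / i!` of the exponential series. -/
noncomputable def expSeq (Ω : Type*) (c : F) : ℕ → Ω → F := fun i _ => c ^ i / (i.factorial : F)

theorem cf_eq_zero {p : Ω → F[X]} {n i : ℕ} (hp : ∀ x, (p x).degree < n) (hi : n ≤ i) (x : Ω) :
    cf p i x = 0 :=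
  (degree_lt_iff_coeff_zero _ _).1 (hp x) i hi

/-- Padding by zeros. -/
theorem Computes.cf_of_degree_lt (h0 : (0 : F) ∈ S) {p : Ω → F[X]} {n m : ℕ}
    (hp : ∀ x, (p x).degree < n) : Computes S (OpMul.seg n (cf p)) (OpMul.seg m (cf p)) 0 := by
  refine .seg_free fun i _ => ?_
  rcases lt_or_ge i n with hi | hi
  · exact .of_mem (mem_seg _ hi)
  · exact .zero h0 fun x => cf_eq_zero hp hi x

theorem computes_natSeq (h0 : (0 : F) ∈ S) (h1 : (1 : F) ∈ S) (n : ℕ) (A : Set (Ω → F)) :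
    Computes S A (seg n (natSeq F Ω)) n := by
  refine (Computes.seg_rec (t := 1) fun i hi => ?_).le (by simp)
  rcases i with _ | i
  · exact (Computes.zero h0 fun x => by simp [natSeq]).le zero_le_one
  · exact .add_eq (.of_mem (.inr (mem_seg (natSeq F Ω) (Nat.lt_succ_self i)))) (.const h1)
      (by norm_num) fun x => by simp [natSeq]

theorem computes_factSeq (h1 : (1 : F) ∈ S) (n : ℕ) :
    Computes S (seg n (natSeq F Ω)) (seg n (factSeq F Ω)) n := by
  refine (Computes.seg_rec (t := 1) fun i hi => ?_).le (by simp)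
  rcases i with _ | i
  · exact .const_eq h1 (fun x => by simp [factSeq]) zero_le_one
  · exact .mul_eq (.of_mem (.inl (mem_seg (natSeq F Ω) hi)))
      (.of_mem (.inr (mem_seg (factSeq F Ω) (Nat.lt_succ_self i)))) (by norm_num)
      fun x => by simp [natSeq, factSeq, Nat.factorial_succ]

theorem computes_expSeq [CharZero F] (h1 : (1 : F) ∈ S) (c : F) (n : ℕ) :
    Computes S (seg n (natSeq F Ω) ∪ {fun _ => c}) (seg n (expSeq Ω c)) (2 * n) := by
  refine (Computes.seg_rec (t := 2) fun i hi => ?_).le (by linarith)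
  rcases i with _ | i
  · exact .const_eq h1 (fun x => by simp [expSeq]) (by norm_num)
  · refine .div_eq (.mul (.of_mem (.inr (mem_seg (expSeq Ω c) (Nat.lt_succ_self i))))
      (.of_mem (.inl (.inr rfl)))) (.of_mem (.inl (.inl (mem_seg (natSeq F Ω) hi))))
      (by norm_num) (fun x => Nat.cast_ne_zero.2 (Nat.succ_ne_zero i)) fun x => ?_
    simp only [expSeq, natSeq, Nat.factorial_succ, pow_succ]
    rw [div_mul_eq_mul_div, div_div]
    push_cast
    congr 1
    ring

variable {N : ℕ} {lam : ℝ}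

theorem ConvBound.series_mul (hC : ConvBound S Ω N lam) {n : ℕ} (hn : n ≤ N)
    (f g : Ω → PowerSeries F) :
    Computes S (seg n (scf f) ∪ seg n (scf g)) (seg n (scf fun x => f x * g x)) (lam * n) := by
  refine hC n hn _ _ _ fun k _ x => ?_
  simp only [scf]
  rw [PowerSeries.coeff_mul, Finset.Nat.sum_antidiagonal_eq_sum_range_succ_mk]

theorem ConvBound.poly_mul (hC : ConvBound S Ω N lam) {n : ℕ} (hn : n ≤ N) (p q : Ω → F[X]) :
    Computes S (seg n (cf p) ∪ seg n (cf q)) (seg n (cf fun x => p x * q x)) (lam * n) := by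
  refine hC n hn _ _ _ fun k _ x => ?_
  simp only [cf]
  rw [coeff_mul, Finset.Nat.sum_antidiagonal_eq_sum_range_succ_mk]

/-- The sums `∑ g l * mu (i + l)` over `l ≤ L`, for `i + L < n`, form a convolution of `g` with the
reversal of `mu`. -/
theorem ConvBound.middle_product (hC : ConvBound S Ω N lam) (h0 : (0 : F) ∈ S) {n₁ L n : ℕ}
    (hn : n ≤ N) (hL : n₁ + L = n) (g mu out : ℕ → Ω → F)
    (hout : ∀ i < n₁, ∀ x, out i x = ∑ l ∈ Finset.range (L + 1), g l x * mu (i + l) x) :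
    Computes S (seg (L + 1) g ∪ seg n mu) (seg n₁ out) (lam * n) := by
  let g' : ℕ → Ω → F := fun l x => if l < L + 1 then g l x else 0
  have hg' : Computes S (seg (L + 1) g) (seg n g') 0 := by
    refine .seg_free fun i _ => ?_
    by_cases hi : i < L + 1
    · have : g' i = g i := funext fun x => if_pos hi
      rw [this]
      exact .of_mem (mem_seg g hi)
    · exact .zero h0 fun x => if_neg hi
  let c : ℕ → Ω → F := fun k x => ∑ l ∈ Finset.range (k + 1), g' l x * mu (n - 1 - (k - l)) x
  have h1 := hC n hn g' (fun i => mu (n - 1 - i)) c fun k _ x => rfl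
  have h2 := ((hg'.left Set.subset_union_left).union
    (Computes.of_subset (S := S) (Set.subset_union_right (s := seg (L + 1) g) (t := seg n mu))
      le_rfl)).trans (h1.left (Set.union_subset (fun v hv => .inr (.inl hv))
        fun v hv => .inr (.inr (seg_reverse_subset n mu hv))))
  refine h2.mono subset_rfl (seg_subset fun i hi => ?_) (by simp)
  refine ⟨n - 1 - i, by simp only [Set.mem_Iio]; omega, ?_⟩
  funext x
  rw [hout i hi]
  simp only [c]
  rw [← Finset.sum_subset (Finset.range_subset_range.2 (show L + 1 ≤ n - 1 - i + 1 by omega))]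
  · refine Finset.sum_congr rfl fun l hl => ?_
    rw [Finset.mem_range] at hl
    simp only [g', if_pos hl]
    rw [show n - 1 - (n - 1 - i - l) = i + l by omega]
  · intro l _ hl
    rw [Finset.mem_range] at hl
    simp only [g', if_neg hl, zero_mul]

theorem choose_eq_div [CharZero F] {i l : ℕ} (h : l ≤ i) :
    (i.choose l : F) = (i.factorial : F) / (l.factorial * (i - l).factorial) :=
  Nat.cast_choose F h

/-- The binomial transform of a sequence is a convolution with an exponential series, up to
factorials. -/
theorem ConvBound.binomial (hC : ConvBound S Ω N lam) [CharZero F] {n : ℕ} (hn : n ≤ N) (c : F)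
    (mu out : ℕ → Ω → F) (hout : ∀ i < n, ∀ x, out i x =
      ∑ l ∈ Finset.range (i + 1), mu l x * ((i.choose l : F) * c ^ (i - l))) :
    Computes S (seg n mu ∪ (seg n (factSeq F Ω) ∪ seg n (expSeq Ω c))) (seg n out)
      (lam * n + 2 * n) := by
  let mu' : ℕ → Ω → F := fun l x => mu l x / l.factorial
  let w : ℕ → Ω → F := fun i x => ∑ l ∈ Finset.range (i + 1), mu' l x * expSeq Ω c (i - l) x
  have hf : ∀ i : ℕ, (i.factorial : F) ≠ 0 := fun i => Nat.cast_ne_zero.2 i.factorial_ne_zero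
  have h1 : Computes S (seg n mu ∪ (seg n (factSeq F Ω) ∪ seg n (expSeq Ω c))) (seg n mu') n :=
    (Computes.seg (t := 1) fun i hi => .div_eq (.of_mem (.inl (mem_seg mu hi)))
      (.of_mem (.inr (.inl (mem_seg (factSeq F Ω) hi)))) (by norm_num) (fun x => hf i)
      fun x => rfl).le (by simp)
  have h2 := h1.seq ((hC n hn mu' (expSeq Ω c) w fun k _ x => rfl).left
    (Set.union_subset (fun v hv => .inr hv) fun v hv => .inl (.inr (.inr hv))))
  refine (h2.trans (C := seg n out) (t := n) ((Computes.seg (t := 1) fun i hi => ?_).le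
    (by simp))).le (by linarith)
  refine .mul_eq (.of_mem (.inr (.inr (mem_seg w hi))))
    (.of_mem (.inl (.inr (.inl (mem_seg (factSeq F Ω) hi))))) (by norm_num) fun x => ?_
  rw [hout i hi x]
  simp only [w, mu', expSeq, factSeq, Finset.sum_mul]
  refine Finset.sum_congr rfl fun l hl => ?_
  rw [choose_eq_div (Nat.lt_succ_iff.1 (Finset.mem_range.1 hl))]
  have := hf l
  have := hf (i - l)
  field_simp

/-- A translation of the variable is the transpose of a binomial transform. -/
theorem ConvBound.taylor (hC : ConvBound S Ω N lam) [CharZero F] {n : ℕ} (hn : n ≤ N) (c : F)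
    (p : Ω → F[X]) (hp : ∀ x, (p x).degree < n) :
    Computes S (seg n (cf p) ∪ (seg n (factSeq F Ω) ∪ seg n (expSeq Ω c)))
      (seg n (cf fun x => taylor c (p x))) (lam * n + 2 * n) := by
  let u : ℕ → Ω → F := fun i x => (p x).coeff i * i.factorial
  let w : ℕ → Ω → F := fun k x =>
    ∑ s ∈ Finset.range (k + 1), u (n - 1 - s) x * expSeq Ω c (k - s) x
  have hf : ∀ i : ℕ, (i.factorial : F) ≠ 0 := fun i => Nat.cast_ne_zero.2 i.factorial_ne_zero
  have h1 : Computes S (seg n (cf p) ∪ (seg n (factSeq F Ω) ∪ seg n (expSeq Ω c))) (seg n u) n :=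
    (Computes.seg (t := 1) fun i hi => .mul_eq (.of_mem (.inl (mem_seg (cf p) hi)))
      (.of_mem (.inr (.inl (mem_seg (factSeq F Ω) hi)))) (by norm_num) fun x => rfl).le (by simp)
  have h2 := h1.seq ((hC n hn (fun i => u (n - 1 - i)) (expSeq Ω c) w fun k _ x => rfl).left
    (Set.union_subset (fun v hv => .inr (seg_reverse_subset n u hv))
      fun v hv => .inl (.inr (.inr hv))))
  refine (h2.trans (C := seg n (cf fun x => Polynomial.taylor c (p x))) (t := n)
    ((Computes.seg (t := 1) fun l hl => ?_).le (by simp))).le (by linarith)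
  refine .div_eq (.of_mem (.inr (.inr (mem_seg w (show n - 1 - l < n by omega)))))
    (.of_mem (.inl (.inr (.inl (mem_seg (factSeq F Ω) hl))))) (by norm_num) (fun x => hf l)
    fun x => ?_
  rw [cf, taylor_coeff_eq_sum c (hp x), ← Finset.sum_range_reflect]
  simp only [w, u, expSeq, factSeq, Finset.sum_div]
  rw [← Finset.sum_subset (Finset.range_subset_range.2 (show n - 1 - l + 1 ≤ n by omega))]
  · refine Finset.sum_congr rfl fun s hs => ?_
    rw [Finset.mem_range] at hs
    rw [choose_eq_div (show l ≤ n - 1 - s by omega), show n - 1 - l - s = n - 1 - s - l by omega]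
    have := hf l
    have := hf (n - 1 - s - l)
    field_simp
  · intro s hs' hs
    rw [Finset.mem_range] at hs hs'
    rw [Nat.choose_eq_zero_of_lt (by omega)]
    simp

end Tools

/-! ### Trees of expansion points -/

section Trees

variable {F : Type*} [Field F] {Ω : Type*} {S : Set F} {N : ℕ} {lam : ℝ}

/-- The constants needed at a node whose children have `m` points each. -/
def level (F Ω : Type*) [Field F] (e m : ℕ) : Set (Ω → F) :=
  seg (e * m + 1) (cf fun _ => nodal F e m) ∪
    (seg (e * m + 1) (cf fun _ => taylor (-(m : F)) (nodal F e m)) ∪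
      seg (e * m + 1) (expSeq Ω (-(m : F))))

/-- The constants needed by a tree of depth `J`. -/
def levels (F Ω : Type*) [Field F] (e J : ℕ) : Set (Ω → F) :=
  ⋃ j ∈ Finset.range J, level F Ω e (2 ^ j)

theorem level_subset_levels {e j J : ℕ} (h : j < J) : level F Ω e (2 ^ j) ⊆ levels F Ω e J := by
  intro v hv
  simp only [levels, Set.mem_iUnion, Finset.mem_range]
  exact ⟨j, h, hv⟩

theorem levels_succ (e J : ℕ) : levels F Ω e (J + 1) = levels F Ω e J ∪ level F Ω e (2 ^ J) := by
  rw [levels, levels, Finset.range_add_one, Finset.set_biUnion_insert, Set.union_comm]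

/-- The first `N` natural numbers and factorials. -/
def tables (F Ω : Type*) [Field F] (N : ℕ) : Set (Ω → F) :=
  seg N (natSeq F Ω) ∪ seg N (factSeq F Ω)

theorem computes_tables (h0 : (0 : F) ∈ S) (h1 : (1 : F) ∈ S) (N : ℕ) (A : Set (Ω → F)) :
    Computes S A (tables F Ω N) (2 * N) :=
  ((computes_natSeq h0 h1 N A).seq ((computes_factSeq h1 N).left Set.subset_union_right)).le
    (by linarith)

theorem computes_neg_natCast (h0 : (0 : F) ∈ S) {m : ℕ} (hm : m < N) :
    Computes S (tables F Ω N) {fun _ => -(m : F)} 1 :=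
  .sub_eq (.const h0) (.of_mem (.inl (mem_seg (natSeq F Ω) hm))) (by norm_num)
    fun x => by simp [natSeq]

variable [CharZero F]

theorem computes_level (hC : ConvBound S Ω N lam) (hlam : 1 ≤ lam) (h0 : (0 : F) ∈ S)
    (h1 : (1 : F) ∈ S) {e m : ℕ} (hm : m < N) (hN : e * (m + m) + 1 ≤ N) :
    Computes S (tables F Ω N ∪ seg (e * m + 1) (cf fun _ => nodal F e m))
      (level F Ω e m ∪ seg (e * (m + m) + 1) (cf fun _ => nodal F e (m + m))) (7 * lam * N) := by
  set n := e * m + 1 with hn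
  have hnN : n ≤ N := by nlinarith
  have hnR : (n : ℝ) ≤ N := by exact_mod_cast hnN
  have hNR : (1 : ℝ) ≤ N := by exact_mod_cast (show 1 ≤ N by omega)
  set Nd : Set (Ω → F) := seg n (cf fun _ => nodal F e m)
  set Ex := seg n (expSeq Ω (-(m : F)))
  set Sh : Set (Ω → F) := seg n (cf fun _ => taylor (-(m : F)) (nodal F e m))
  set T := tables F Ω N
  have hfact : seg n (factSeq F Ω) ⊆ T := fun v hv => .inr (seg_mono _ hnN hv)
  have hnat : seg n (natSeq F Ω) ⊆ T := fun v hv => .inl (seg_mono _ hnN hv)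
  have c1 : Computes S (T ∪ Nd) ({fun _ => -(m : F)} ∪ Ex) (1 + 2 * n) :=
    ((computes_neg_natCast h0 hm).left Set.subset_union_left).seq
      ((computes_expSeq h1 _ n).left (by tauto_set))
  have c2 : Computes S (T ∪ Nd ∪ ({fun _ => -(m : F)} ∪ Ex)) Sh (lam * n + 2 * n) :=
    (hC.taylor hnN (-(m : F)) (fun _ => nodal F e m) fun _ => nodal_degree_lt e m).left
      (by tauto_set)
  have c3 : Computes S (T ∪ Nd ∪ (({fun _ => -(m : F)} ∪ Ex) ∪ Sh))
      (seg (e * (m + m) + 1) (cf fun _ => nodal F e (m + m))) (0 + 0 + lam * N) := by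
    have h2 : (fun _ : Ω => nodal F e (m + m)) =
        fun _ => nodal F e m * taylor (-(m : F)) (nodal F e m) :=
      funext fun _ => nodal_add e m m
    rw [h2]
    refine Computes.trans (B := seg (e * (m + m) + 1) (cf fun _ => nodal F e m) ∪
      seg (e * (m + m) + 1) (cf fun _ => taylor (-(m : F)) (nodal F e m)))
      (.union (.left (.cf_of_degree_lt h0 fun _ => nodal_degree_lt e m) ?_)
        (.left (.cf_of_degree_lt h0 fun _ => taylor_degree_lt _ (nodal_degree_lt e m)) ?_)) ?_
    · tauto_set
    · tauto_set
    · refine ((hC.poly_mul hN _ _).le ?_).left Set.subset_union_right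
      exact mul_le_mul_of_nonneg_left (by exact_mod_cast hN) (by linarith)
  refine (((c1.seq c2).seq c3).union (Computes.of_subset (B := Nd) Set.subset_union_right le_rfl)).mono
    subset_rfl ?_ ?_
  · rw [level]
    tauto_set
  · nlinarith [mul_le_mul_of_nonneg_left hnR (show 0 ≤ lam by linarith),
      mul_le_mul_of_nonneg_right hlam (show (0 : ℝ) ≤ N by linarith)]

/-- The moduli of all levels, each obtained from the previous one by a translation and a product. -/
theorem computes_levels (hC : ConvBound S Ω N lam) (hlam : 1 ≤ lam) (h0 : (0 : F) ∈ S)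
    (h1 : (1 : F) ∈ S) {e : ℕ} (he : 0 < e) (J : ℕ) (hN : e * 2 ^ J + 1 ≤ N) :
    Computes S (tables F Ω N)
      (levels F Ω e J ∪ seg (e * 2 ^ J + 1) (cf fun _ => nodal F e (2 ^ J)))
      (7 * lam * N * J) := by
  induction J with
  | zero =>
    refine (Computes.of_forall ?_).le (by simp)
    rintro _ (h | ⟨i, _, rfl⟩)
    · simp [levels] at h
    · have h2 : cf (fun _ : Ω => nodal F e (2 ^ 0)) i = fun _ => if i = e then 1 else 0 := by
        funext x
        rw [cf, pow_zero, nodal_one, coeff_X_pow]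
      rw [h2]
      split_ifs
      · exact .const h1
      · exact .const h0
  | succ J ih =>
    have h2 : (2 : ℕ) ^ (J + 1) = 2 ^ J + 2 ^ J := by ring
    rw [h2] at hN ⊢
    rw [levels_succ]
    have hm : 2 ^ J < N := by nlinarith
    refine ((ih (by nlinarith)).seq ((computes_level hC hlam h0 h1 hm hN).left
      (by tauto_set))).mono subset_rfl (by tauto_set) ?_
    push_cast
    linarith

/-- From the moments at the root of the tree to the expansions at all points. -/
theorem computes_eval_tree (hC : ConvBound S Ω N lam) (hlam : 1 ≤ lam) (h0 : (0 : F) ∈ S)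
    {e : ℕ} (he : 0 < e) {J : ℕ} (hN : e * 2 ^ J + 1 ≤ N) {j : ℕ} (hj : j ≤ J) (q : Ω → F[X]) :
    Computes S (seg (e * 2 ^ j) (fun i x => mom e (2 ^ j) (q x) i) ∪
        (tables F Ω N ∪ levels F Ω e J))
      (⋃ k ∈ Finset.range (2 ^ j), seg e (cf fun x => taylor (k : F) (q x)))
      (7 * lam * (e * 2 ^ j : ℕ) * j) := by
  induction j generalizing q with
  | zero =>
    refine (Computes.of_subset (fun v hv => .inl ?_) le_rfl).le (by simp)
    simp only [pow_zero, Finset.range_one, Finset.mem_singleton, Set.iUnion_iUnion_eq_left,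
      Nat.cast_zero, taylor_zero] at hv
    obtain ⟨i, hi, rfl⟩ := hv
    rw [Set.mem_Iio] at hi
    refine ⟨e - 1 - i, by simp only [Set.mem_Iio]; omega, ?_⟩
    funext x
    simp only [pow_zero, cf]
    rw [mom_one (by omega), show e - 1 - (e - 1 - i) = i by omega]
  | succ j ih =>
    set n := e * 2 ^ j with hn
    have hn2 : e * 2 ^ (j + 1) = n + n := by rw [hn]; ring
    have hle : n + n ≤ N := by
      have : e * 2 ^ (j + 1) ≤ e * 2 ^ J :=
        Nat.mul_le_mul_left _ (Nat.pow_le_pow_right (by omega) hj)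
      omega
    have hm0 : 0 < 2 ^ j := by positivity
    have h2 : (2 : ℕ) ^ (j + 1) = 2 ^ j + 2 ^ j := by ring
    rw [hn2, h2]
    set E := tables F Ω N ∪ levels F Ω e J
    have hlev : level F Ω e (2 ^ j) ⊆ E := (level_subset_levels hj).trans Set.subset_union_right
    have hNd : seg (n + 1) (cf fun _ => nodal F e (2 ^ j)) ⊆ E := fun v hv => hlev (.inl hv)
    have hSh : seg (n + 1) (cf fun _ => taylor (-((2 ^ j : ℕ) : F)) (nodal F e (2 ^ j))) ⊆ E :=
      fun v hv => hlev (.inr (.inl hv))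
    have hEx : seg n (expSeq Ω (-((2 ^ j : ℕ) : F))) ⊆ E :=
      fun v hv => hlev (.inr (.inr (seg_mono _ (Nat.le_succ n) hv)))
    have hFa : seg n (factSeq F Ω) ⊆ E := fun v hv => .inl (.inr (seg_mono _ (by omega) hv))
    set Mo := seg (n + n) (fun i (x : Ω) => mom e (2 ^ j + 2 ^ j) (q x) i)
    have c1 : Computes S (Mo ∪ E) (seg n fun i x => mom e (2 ^ j) (q x) i) (lam * (n + n : ℕ)) :=
      (hC.middle_product h0 hle rfl (cf fun _ => taylor (-((2 ^ j : ℕ) : F)) (nodal F e (2 ^ j)))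
        (fun i x => mom e (2 ^ j + 2 ^ j) (q x) i) (fun i x => mom e (2 ^ j) (q x) i)
        fun i _ x => mom_eq_sum he hm0 (q x) i).left
          (Set.union_subset (hSh.trans Set.subset_union_right) Set.subset_union_left)
    have c2 : Computes S (Mo ∪ E) (seg n fun i x => momShift e (2 ^ j) (q x) i)
        (lam * (n + n : ℕ)) :=
      (hC.middle_product h0 hle rfl (cf fun _ => nodal F e (2 ^ j))
        (fun i x => mom e (2 ^ j + 2 ^ j) (q x) i) (fun i x => momShift e (2 ^ j) (q x) i)
        fun i _ x => momShift_eq_sum he hm0 (q x) i).left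
          (Set.union_subset (hNd.trans Set.subset_union_right) Set.subset_union_left)
    have c3 : Computes S (Mo ∪ E)
        (seg n fun i x => mom e (2 ^ j) (taylor ((2 ^ j : ℕ) : F) (q x)) i)
        (lam * (n + n : ℕ) + (lam * n + 2 * n)) :=
      c2.trans ((hC.binomial (by omega) (-((2 ^ j : ℕ) : F))
        (fun i x => momShift e (2 ^ j) (q x) i)
        (fun i x => mom e (2 ^ j) (taylor ((2 ^ j : ℕ) : F) (q x)) i)
        fun i _ x => mom_taylor he hm0 (q x) i).left (Set.union_subset Set.subset_union_right
          (Set.union_subset (fun v hv => .inl (.inr (hFa hv))) fun v hv => .inl (.inr (hEx hv)))))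
    have c4 := c1.trans ((ih (by omega) q).left
      (A' := Mo ∪ E ∪ seg n fun i x => mom e (2 ^ j) (q x) i)
      (Set.union_subset Set.subset_union_right fun v hv => .inl (.inr hv)))
    have c5 := c3.trans ((ih (by omega) fun x => taylor ((2 ^ j : ℕ) : F) (q x)).left
      (A' := Mo ∪ E ∪ seg n fun i x => mom e (2 ^ j) (taylor ((2 ^ j : ℕ) : F) (q x)) i)
      (Set.union_subset Set.subset_union_right fun v hv => .inl (.inr hv)))
    refine (c4.union c5).mono subset_rfl ?_ ?_
    · intro v hv
      simp only [Set.mem_iUnion, Finset.mem_range, Set.mem_union, exists_prop] at hv ⊢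
      obtain ⟨k, hk, hv⟩ := hv
      rcases lt_or_ge k (2 ^ j) with h | h
      · exact .inl ⟨k, h, hv⟩
      · refine .inr ⟨k - 2 ^ j, by omega, ?_⟩
        simp only [taylor_taylor, ← Nat.cast_add]
        rwa [Nat.sub_add_cancel h]
    · have hnl : (n : ℝ) ≤ lam * n := le_mul_of_one_le_left (by positivity) hlam
      push_cast
      nlinarith

/-- Combination of local data into a polynomial, from the leaves of the tree to its root. -/
theorem computes_comb (hC : ConvBound S Ω N lam) (hlam : 1 ≤ lam) (h0 : (0 : F) ∈ S)
    {e : ℕ} {J : ℕ} (hN : e * 2 ^ J + 1 ≤ N) {j : ℕ} (hj : j ≤ J) (c : ℕ → Ω → F[X])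
    (hc : ∀ k x, (c k x).degree < e) :
    Computes S ((⋃ k ∈ Finset.range (2 ^ j), seg e (cf (c k))) ∪
        (tables F Ω N ∪ levels F Ω e J))
      (seg (e * 2 ^ j) (cf fun x => comb e j fun k => c k x))
      (7 * lam * (e * 2 ^ j : ℕ) * j) := by
  induction j generalizing c with
  | zero => exact (Computes.of_subset (by simp [comb]) le_rfl).le (by simp)
  | succ j ih =>
    set n := e * 2 ^ j with hn
    have hn2 : e * 2 ^ (j + 1) = n + n := by rw [hn]; ring
    have hle : n + n ≤ N := by
      have : e * 2 ^ (j + 1) ≤ e * 2 ^ J :=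
        Nat.mul_le_mul_left _ (Nat.pow_le_pow_right (by omega) hj)
      omega
    have h2 : (2 : ℕ) ^ (j + 1) = 2 ^ j + 2 ^ j := by ring
    rw [hn2, h2]
    set E := tables F Ω N ∪ levels F Ω e J
    have hlev : level F Ω e (2 ^ j) ⊆ E := (level_subset_levels hj).trans Set.subset_union_right
    set Nd : Ω → F[X] := fun _ => nodal F e (2 ^ j) with hNd_def
    set Sh : Ω → F[X] := fun _ => taylor (-((2 ^ j : ℕ) : F)) (nodal F e (2 ^ j)) with hSh_def
    have hNd : seg (n + 1) (cf Nd) ⊆ E := fun v hv => hlev (.inl hv)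
    have hSh : seg (n + 1) (cf Sh) ⊆ E := fun v hv => hlev (.inr (.inl hv))
    have hEx : seg n (expSeq Ω (-((2 ^ j : ℕ) : F))) ⊆ E :=
      fun v hv => hlev (.inr (.inr (seg_mono _ (Nat.le_succ n) hv)))
    have hFa : seg n (factSeq F Ω) ⊆ E := fun v hv => .inl (.inr (seg_mono _ (by omega) hv))
    set A := (⋃ k ∈ Finset.range (2 ^ j + 2 ^ j), seg e (cf (c k))) ∪ E
    set P : Ω → F[X] := fun x => comb e j fun k => c k x with hP
    set Q₀ : Ω → F[X] := fun x => comb e j fun k => c (2 ^ j + k) x with hQ₀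
    set Q : Ω → F[X] := fun x => taylor (-((2 ^ j : ℕ) : F)) (Q₀ x) with hQ
    have hPd : ∀ x, (P x).degree < (n : WithBot ℕ) := fun x => comb_degree_lt fun k => hc k x
    have hQ₀d : ∀ x, (Q₀ x).degree < (n : WithBot ℕ) := fun x => comb_degree_lt fun k => hc _ x
    have c1 : Computes S A (seg n (cf P)) (7 * lam * n * j) := by
      refine (ih (by omega) c hc).left (Set.union_subset_union_left _ ?_)
      exact Set.biUnion_subset_biUnion_left (by
        intro k hk
        simp only [Finset.mem_coe, Finset.mem_range] at hk ⊢
        omega)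
    have c2 : Computes S A (seg n (cf Q₀)) (7 * lam * n * j) := by
      refine (ih (by omega) (fun k => c (2 ^ j + k)) fun k => hc _).left
        (Set.union_subset_union_left _ ?_)
      refine Set.iUnion₂_subset fun k hk => ?_
      rw [Finset.mem_range] at hk
      exact Set.subset_biUnion_of_mem (u := fun k => seg e (cf (c k)))
        (show 2 ^ j + k ∈ (Finset.range (2 ^ j + 2 ^ j) : Set ℕ) by simpa using hk)
    have c3 : Computes S A (seg n (cf Q)) (7 * lam * n * j + (lam * n + 2 * n)) :=
      c2.trans ((hC.taylor (by omega) (-((2 ^ j : ℕ) : F)) Q₀ hQ₀d).left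
        (Set.union_subset Set.subset_union_right
          (Set.union_subset (fun v hv => .inl (.inr (hFa hv))) fun v hv => .inl (.inr (hEx hv)))))
    have p1 : Computes S (A ∪ (seg n (cf P) ∪ seg n (cf Q)))
        ((seg (n + n) (cf P) ∪ seg (n + n) (cf Sh)) ∪ (seg (n + n) (cf Q) ∪ seg (n + n) (cf Nd)))
        ((0 + 0) + (0 + 0)) :=
      .union
        (.union ((Computes.cf_of_degree_lt h0 hPd).left fun v hv => .inr (.inl hv))
          ((Computes.cf_of_degree_lt (n := n + 1) h0
            fun _ => taylor_degree_lt _ (nodal_degree_lt e _)).left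
              fun v hv => .inl (.inr (hSh hv))))
        (.union ((Computes.cf_of_degree_lt h0 fun x => taylor_degree_lt _ (hQ₀d x)).left
            fun v hv => .inr (.inr hv))
          ((Computes.cf_of_degree_lt (n := n + 1) h0
            fun _ => nodal_degree_lt e _).left fun v hv => .inl (.inr (hNd hv))))
    have c4 := p1.trans (((hC.poly_mul hle P Sh).left fun v hv => .inr (.inl hv)).union
      ((hC.poly_mul hle Q Nd).left fun v hv => .inr (.inr hv)))
    refine ((c1.union c3).trans (c4.trans (t := (n + n : ℕ)) ?_)).le ?_
    · refine (Computes.seg (t := 1) fun i hi => ?_).le (by simp)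
      refine .add_eq (.of_mem (.inr (.inl (mem_seg _ hi)))) (.of_mem (.inr (.inr (mem_seg _ hi))))
        (by norm_num) fun x => ?_
      simp only [cf, comb, coeff_add, P, Sh, Q, Nd, Q₀]
    · have hnl : (n : ℝ) ≤ lam * n := le_mul_of_one_le_left (by positivity) hlam
      push_cast
      nlinarith

end Trees

/-! ### Evaluation and interpolation at all points -/

section Evaluation

variable {F : Type*} [Field F] {Ω : Type*} {S : Set F} {N : ℕ} {lam : ℝ}

/-- Every step is performed at the full precision `n`, which costs no more than a factor
`O(log n)`. -/
theorem computes_newtonInv (hC : ConvBound S Ω N lam) (hlam : 1 ≤ lam) (h0 : (0 : F) ∈ S)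
    (h1 : (1 : F) ∈ S) {n : ℕ} (hn : n ≤ N) (f : PowerSeries F) (s : ℕ) :
    Computes S (seg n (scf fun _ : Ω => f)) (seg n (scf fun _ : Ω => newtonInv f s))
      (4 * lam * n * s) := by
  induction s with
  | zero =>
    refine (Computes.seg_free fun i _ => ?_).le (by simp)
    rcases eq_or_ne i 0 with rfl | hi
    · exact .const_eq h1 (fun x => by simp [scf, newtonInv]) le_rfl
    · exact .zero h0 fun x => by simp [scf, newtonInv, PowerSeries.coeff_one, hi]
  | succ s ih =>
    have c1 := ih.seq ((hC.series_mul hn (fun _ => f) fun _ => newtonInv f s).left subset_rfl)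
    have c2 : Computes S (seg n (scf fun _ : Ω => f) ∪ (seg n (scf fun _ : Ω => newtonInv f s) ∪
        seg n (scf fun _ : Ω => f * newtonInv f s)))
        (seg n (scf fun _ : Ω => 2 - f * newtonInv f s)) (2 * n) := by
      refine (Computes.seg (t := 2) fun i hi => ?_).le (by linarith)
      rcases eq_or_ne i 0 with rfl | hi0
      · refine .sub_eq (.add (.const h1) (.const h1)) (.of_mem (.inr (.inr (mem_seg _ hi))))
          (by norm_num) fun x => ?_
        simp only [scf, map_sub]
        congr 1
        rw [PowerSeries.coeff_zero_eq_constantCoeff, map_ofNat]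
        norm_num
      · refine .sub_eq (.const h0) (.of_mem (.inr (.inr (mem_seg _ hi))))
          (by norm_num) fun x => ?_
        simp only [scf, map_sub]
        congr 1
        rw [show (2 : PowerSeries F) = PowerSeries.C 2 from (map_ofNat _ 2).symm,
          PowerSeries.coeff_C, if_neg hi0]
    refine ((c1.seq c2).trans ((hC.series_mul hn (fun _ => newtonInv f s)
      fun _ => 2 - f * newtonInv f s).left
        (Set.union_subset (fun v hv => .inr (.inl (.inl hv))) fun v hv => .inr (.inr hv)))).le ?_
    have : (n : ℝ) ≤ lam * n := le_mul_of_one_le_left (by positivity) hlam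
    push_cast
    nlinarith

theorem mk_revCoeff_mul_mk_infInv {G : F[X]} (hG : G.Monic) (hd : 0 < G.natDegree) :
    PowerSeries.mk (revCoeff G) * PowerSeries.mk (infInv G) = 1 := by
  ext t
  rw [PowerSeries.coeff_mul, Finset.Nat.sum_antidiagonal_eq_sum_range_succ_mk,
    PowerSeries.coeff_one]
  simp only [PowerSeries.coeff_mk]
  exact sum_revCoeff_mul_infInv hG hd t

theorem computes_infInv (hC : ConvBound S Ω N lam) (hlam : 1 ≤ lam) (h0 : (0 : F) ∈ S)
    (h1 : (1 : F) ∈ S) {G : F[X]} (hG : G.Monic) {D : ℕ} (hD : G.natDegree = D) (hd : 0 < D)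
    (hn : D ≤ N) {s : ℕ} (hs : D ≤ 2 ^ s) :
    Computes S (seg (D + 1) (cf fun _ : Ω => G)) (seg D fun u _ => infInv G u)
      (4 * lam * D * s) := by
  subst hD
  have c1 : Computes S (seg (G.natDegree + 1) (cf fun _ : Ω => G))
      (seg G.natDegree (scf fun _ : Ω => PowerSeries.mk (revCoeff G))) 0 := by
    refine .of_subset (seg_subset fun i hi => ⟨G.natDegree - i, ?_, ?_⟩) le_rfl
    · simp only [Set.mem_Iio]
      omega
    · funext x
      simp [scf, cf, revCoeff, hi.le]
  refine (c1.trans ((computes_newtonInv hC hlam h0 h1 hn (PowerSeries.mk (revCoeff G)) s).left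
    Set.subset_union_right)).mono subset_rfl ?_ (by simp)
  refine (seg_congr fun i hi => ?_).subset
  funext x
  rw [scf, coeff_newtonInv _ (mk_revCoeff_mul_mk_infInv hG hd) (hi.trans_le hs),
    PowerSeries.coeff_mk]
  rw [← PowerSeries.coeff_zero_eq_constantCoeff_apply, PowerSeries.coeff_mk]
  simpa [revCoeff] using hG.leadingCoeff

/-- The constants needed for the simultaneous expansion at the points `0, …, 2 ^ J - 1`. -/
def evalData (F Ω : Type*) [Field F] (N e J : ℕ) : Set (Ω → F) :=
  (tables F Ω N ∪ levels F Ω e J) ∪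
    seg (e * 2 ^ J) fun u _ => infInv (nodal F e (2 ^ J)) u

variable [CharZero F]

theorem computes_evalData (hC : ConvBound S Ω N lam) (hlam : 1 ≤ lam) (h0 : (0 : F) ∈ S)
    (h1 : (1 : F) ∈ S) {e : ℕ} (he : 0 < e) {J : ℕ} (hN : e * 2 ^ J + 1 ≤ N) {s : ℕ}
    (hs : e * 2 ^ J ≤ 2 ^ s) (A : Set (Ω → F)) :
    Computes S A (evalData F Ω N e J) (2 * N + 7 * lam * N * J + 4 * lam * N * s) := by
  have c1 := (computes_tables h0 h1 N A).seq ((computes_levels hC hlam h0 h1 he J hN).left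
    (Set.subset_union_right (s := A)))
  have c2 := c1.seq ((computes_infInv hC hlam h0 h1 (nodal_monic e (2 ^ J))
    (nodal_natDegree e (2 ^ J)) (by positivity) (by omega) hs).left
      fun v hv => .inr (.inr (.inr hv)))
  refine c2.mono subset_rfl ?_ ?_
  · rintro v ((hv | hv) | hv)
    · exact .inl (.inl hv)
    · exact .inl (.inr (.inl hv))
    · exact .inr hv
  · have : ((e * 2 ^ J : ℕ) : ℝ) ≤ N := by exact_mod_cast (by omega)
    gcongr

/-- Simultaneous expansion of a polynomial at the points `0, …, 2 ^ J - 1`, to the order `e`. -/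
theorem computes_eval (hC : ConvBound S Ω N lam) (hlam : 1 ≤ lam) (h0 : (0 : F) ∈ S)
    {e : ℕ} (he : 0 < e) {J : ℕ} (hN : e * 2 ^ J + 1 ≤ N) (p : Ω → F[X])
    (hp : ∀ x, (p x).degree < ((e * 2 ^ J : ℕ) : WithBot ℕ)) :
    Computes S (seg (e * 2 ^ J) (cf p) ∪ evalData F Ω N e J)
      (⋃ k ∈ Finset.range (2 ^ J), seg e (cf fun x => taylor (k : F) (p x)))
      (7 * lam * N * (J + 1)) := by
  set D := e * 2 ^ J with hD
  have hDN : (D : ℝ) ≤ N := by exact_mod_cast (by omega)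
  have c1 : Computes S (seg D (cf p) ∪ evalData F Ω N e J)
      (seg D fun i x => mom e (2 ^ J) (p x) i) (lam * D) := by
    refine (hC D (by omega) (fun i => cf p (D - 1 - i))
      (fun u _ => infInv (nodal F e (2 ^ J)) u) _ fun i hi x => ?_).left
        (Set.union_subset ((seg_reverse_subset D (cf p)).trans Set.subset_union_left)
          fun v hv => .inr (.inr hv))
    simp only [mom, cf]
    rw [rho_X_pow_mul_eq_sum (nodal_monic _ _) (by rw [nodal_natDegree]; exact hp x)
      (by rw [nodal_natDegree]; exact hi), nodal_natDegree]
  refine (c1.trans ((computes_eval_tree hC hlam h0 he hN le_rfl p).left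
    (Set.union_subset Set.subset_union_right fun v hv => .inl (.inr (.inl hv))))).le ?_
  have h2 : lam * D ≤ lam * N := mul_le_mul_of_nonneg_left hDN (by linarith)
  have h3 : lam * D * J ≤ lam * N * J := mul_le_mul_of_nonneg_right h2 (by positivity)
  have h4 : 0 ≤ lam * N := by positivity
  nlinarith

end Evaluation

section Interpolation

variable {F : Type*} [Field F] {Ω : Type*} {S : Set F} {N : ℕ} {lam : ℝ}

theorem mul_inv_X_add_C {a : F} (ha : a ≠ 0) :
    (PowerSeries.X + PowerSeries.C a : PowerSeries F) * (PowerSeries.X + PowerSeries.C a)⁻¹ = 1 :=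
  PowerSeries.mul_inv_cancel _ (by simpa using ha)

/-- Division of a power series by `X + a`: one division and one subtraction per coefficient. -/
theorem computes_div_X_add_C {a : F} (ha : a ≠ 0) (n : ℕ) (f : PowerSeries F) :
    Computes S ({fun _ : Ω => a} ∪ seg n (scf fun _ : Ω => f))
      (seg n (scf fun _ : Ω => f * (PowerSeries.X + PowerSeries.C a)⁻¹)) (2 * n) := by
  set g := f * (PowerSeries.X + PowerSeries.C a)⁻¹ with hg
  have hfg : f = PowerSeries.X * g + PowerSeries.C a * g := by
    rw [← add_mul, hg, mul_left_comm, mul_inv_X_add_C ha, mul_one]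
  refine (Computes.seg_rec (t := 2) fun i hi => ?_).le (by linarith)
  rcases i with _ | i
  · refine .div_eq (.of_mem (.inl (.inr (mem_seg _ hi)))) (.of_mem (.inl (.inl rfl)))
      (by norm_num) (fun _ => ha) fun x => ?_
    rw [eq_div_iff ha]
    simp only [scf]
    conv_rhs => rw [hfg]
    simp [mul_comm]
  · refine .div_eq (.sub (.of_mem (.inl (.inr (mem_seg _ hi))))
      (.of_mem (.inr (mem_seg _ (Nat.lt_succ_self i))))) (.of_mem (.inl (.inl rfl)))
      (by norm_num) (fun _ => ha) fun x => ?_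
    rw [eq_div_iff ha]
    simp only [scf]
    conv_rhs => rw [hfg]
    simp [PowerSeries.coeff_succ_X_mul, mul_comm]

theorem computes_div_X_add_C_pow {a : F} (ha : a ≠ 0) (n : ℕ) (f : PowerSeries F) (e : ℕ) :
    Computes S ({fun _ : Ω => a} ∪ seg n (scf fun _ : Ω => f))
      (seg n (scf fun _ : Ω => f * ((PowerSeries.X + PowerSeries.C a)⁻¹) ^ e)) (2 * n * e) := by
  induction e with
  | zero => exact (Computes.of_subset (by simp) le_rfl).le (by simp)
  | succ e ih =>
    simp only [pow_succ, ← mul_assoc]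
    refine (ih.trans ((computes_div_X_add_C ha n _).left
      (Set.union_subset_union_left _ Set.subset_union_left))).le ?_
    push_cast
    linarith

/-- The inverse of the product of the `(X + a i) ^ e` over `i < k`. -/
noncomputable def invProd (e : ℕ) (a : ℕ → F) (k : ℕ) : PowerSeries F :=
  ∏ i ∈ Finset.range k, ((PowerSeries.X + PowerSeries.C (a i))⁻¹) ^ e

theorem prod_mul_invProd (e : ℕ) {a : ℕ → F} (ha : ∀ i, a i ≠ 0) (k : ℕ) :
    (∏ i ∈ Finset.range k, (PowerSeries.X + PowerSeries.C (a i)) ^ e) * invProd e a k = 1 := by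
  rw [invProd, ← Finset.prod_mul_distrib]
  refine Finset.prod_eq_one fun i _ => ?_
  rw [← mul_pow, mul_inv_X_add_C (ha i), one_pow]

theorem computes_invProd (h0 : (0 : F) ∈ S) (h1 : (1 : F) ∈ S) {A : Set (Ω → F)} {a : ℕ → F}
    (ha : ∀ i, a i ≠ 0) {m : ℕ} (hA : ∀ i < m, Computes S A {fun _ => a i} 1) (e : ℕ) :
    Computes S A (⋃ k ∈ Finset.range (m + 1), seg e (scf fun _ : Ω => invProd e a k))
      ((m + 1) * (1 + 2 * e * e)) := by
  refine (Computes.accumulate (t := 1 + 2 * e * e) fun k hk => ?_).le (by push_cast; rfl)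
  rcases k with _ | k
  · refine (Computes.seg_free fun i _ => ?_).le (by positivity)
    rcases eq_or_ne i 0 with rfl | hi
    · exact .const_eq h1 (fun x => by simp [scf, invProd]) le_rfl
    · exact .zero h0 fun x => by simp [scf, invProd, PowerSeries.coeff_one, hi]
  · simp only [invProd, Finset.prod_range_succ]
    refine ((hA k (by omega)).left Set.subset_union_left).trans
      ((computes_div_X_add_C_pow (ha k) e _ e).left ?_)
    refine Set.union_subset Set.subset_union_right fun v hv => .inl (.inr ?_)
    simp only [Set.mem_iUnion, Finset.mem_range]
    exact ⟨k, Nat.lt_succ_self k, hv⟩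

/-- The inverse of `cofactor F e m k`, as a power series. It is a product of two factors that depend
only on `k` and on `m - 1 - k`, so that all of them are obtained from two sequences. -/
noncomputable def cofactorInv (F : Type*) [Field F] (e m k : ℕ) : PowerSeries F :=
  invProd e (fun i => ((i + 1 : ℕ) : F)) k * invProd e (fun i => -((i + 1 : ℕ) : F)) (m - 1 - k)

theorem cofactor_mul_cofactorInv [CharZero F] (e m k : ℕ) :
    (cofactor F e m k : PowerSeries F) * cofactorInv F e m k = 1 := by
  have hn : ∀ i : ℕ, ((i + 1 : ℕ) : F) ≠ 0 := fun i => Nat.cast_ne_zero.2 (Nat.succ_ne_zero i)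
  have h1 := prod_mul_invProd e hn k
  have h2 := prod_mul_invProd e (fun i => neg_ne_zero.2 (hn i)) (m - 1 - k)
  have h3 : (cofactor F e m k : PowerSeries F) =
      (∏ i ∈ Finset.range k, (PowerSeries.X + PowerSeries.C ((i + 1 : ℕ) : F)) ^ e) *
        ∏ i ∈ Finset.range (m - 1 - k), (PowerSeries.X + PowerSeries.C (-((i + 1 : ℕ) : F))) ^ e := by
    rw [cofactor, ← Polynomial.coeToPowerSeries.ringHom_apply, map_mul, map_prod, map_prod]
    simp only [map_pow, map_add, Polynomial.coeToPowerSeries.ringHom_apply,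
      Polynomial.coe_X, Polynomial.coe_C, map_neg, sub_eq_add_neg]
  rw [h3, cofactorInv, mul_mul_mul_comm, h1, h2, one_mul]

/-- The constants needed for the interpolation at the points `0, …, m - 1`. -/
def cofactorData (F Ω : Type*) [Field F] (e m : ℕ) : Set (Ω → F) :=
  ⋃ k ∈ Finset.range m, seg e (scf fun _ => cofactorInv F e m k)

theorem computes_cofactorData [CharZero F] (hC : ConvBound S Ω N lam) (h0 : (0 : F) ∈ S)
    (h1 : (1 : F) ∈ S) {e m : ℕ} (he : e ≤ N) (hm : m < N) :
    Computes S (tables F Ω N) (cofactorData F Ω e m)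
      (2 * (m + 1) * (1 + 2 * e * e) + m * (lam * e)) := by
  have hn : ∀ i : ℕ, ((i + 1 : ℕ) : F) ≠ 0 := fun i => Nat.cast_ne_zero.2 (Nat.succ_ne_zero i)
  have c1 := computes_invProd (Ω := Ω) (A := tables F Ω N) (m := m) h0 h1 hn
    (fun i hi => (Computes.of_mem (.inl (mem_seg (natSeq F Ω) (show i + 1 < N by omega)))).le
      zero_le_one) e
  have c2 := computes_invProd (Ω := Ω) (A := tables F Ω N) (m := m) h0 h1
    (fun i => neg_ne_zero.2 (hn i))
    (fun i hi => computes_neg_natCast h0 (show i + 1 < N by omega)) e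
  refine ((c1.union c2).trans (Computes.biUnion_lt (t := lam * e) fun k hk => ?_)).le (by linarith)
  refine (hC.series_mul he (fun _ => invProd e (fun i => ((i + 1 : ℕ) : F)) k)
    fun _ => invProd e (fun i => -((i + 1 : ℕ) : F)) (m - 1 - k)).left ?_
  refine Set.union_subset (fun v hv => .inr (.inl ?_)) fun v hv => .inr (.inr ?_)
  · simp only [Set.mem_iUnion, Finset.mem_range]
    exact ⟨k, by omega, hv⟩
  · simp only [Set.mem_iUnion, Finset.mem_range]
    exact ⟨m - 1 - k, by omega, hv⟩

theorem trunc_degree_lt (e : ℕ) (f : PowerSeries F) : (PowerSeries.trunc e f).degree < e := by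
  rw [degree_lt_iff_coeff_zero]
  intro m hm
  rw [PowerSeries.coeff_trunc, if_neg (by omega)]

/-- Division by `g` modulo `X ^ e`, by means of the inverse `w` of `g`. -/
theorem X_pow_dvd_trunc_mul_sub (e : ℕ) {p g : F[X]} {w : PowerSeries F}
    (hw : (g : PowerSeries F) * w = 1) : 
    X ^ e ∣ PowerSeries.trunc e ((p : PowerSeries F) * w) * g - p := by
  have h1 : (PowerSeries.X : PowerSeries F) ^ e ∣ (PowerSeries.trunc e ((p : PowerSeries F) * w) : PowerSeries F) -
      (p : PowerSeries F) * w := by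
    rw [PowerSeries.X_pow_dvd_iff]
    intro m hm
    rw [map_sub, Polynomial.coeff_coe, PowerSeries.coeff_trunc, if_pos hm, sub_self]
  have h2 : (PowerSeries.X : PowerSeries F) ^ e ∣
      ((PowerSeries.trunc e ((p : PowerSeries F) * w) * g - p : F[X]) : PowerSeries F) := by
    have := h1.mul_right (g : PowerSeries F)
    rw [sub_mul, mul_assoc, mul_comm w, hw, mul_one] at this
    rwa [Polynomial.coe_sub, Polynomial.coe_mul]
  rw [PowerSeries.X_pow_dvd_iff] at h2
  rw [Polynomial.X_pow_dvd_iff]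
  intro m hm
  rw [← Polynomial.coeff_coe]
  exact h2 m hm

/-- Interpolation of a polynomial from its expansions at the points `0, …, 2 ^ J - 1`. -/
theorem computes_interp [CharZero F] (hC : ConvBound S Ω N lam) (hlam : 1 ≤ lam)
    (h0 : (0 : F) ∈ S) {e : ℕ} {J : ℕ} (hN : e * 2 ^ J + 1 ≤ N) (p : Ω → F[X])
    (hp : ∀ x, (p x).degree < ((e * 2 ^ J : ℕ) : WithBot ℕ)) :
    Computes S ((⋃ k ∈ Finset.range (2 ^ J), seg e (cf fun x => taylor (k : F) (p x))) ∪
        ((tables F Ω N ∪ levels F Ω e J) ∪ cofactorData F Ω e (2 ^ J)))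
      (seg (e * 2 ^ J) (cf p)) (7 * lam * N * (J + 1)) := by
  set m := 2 ^ J with hm
  have hm0 : 0 < m := by positivity
  let c : ℕ → Ω → F[X] := fun k x =>
    PowerSeries.trunc e ((taylor (k : F) (p x) : PowerSeries F) * cofactorInv F e m k)
  have hc : ∀ k x, (c k x).degree < e := fun k x => trunc_degree_lt _ _
  have hcomb : ∀ x, comb e J (fun k => c k x) = p x := by
    intro x
    refine eq_of_forall_taylor (comb_degree_lt fun k => hc k x) (hp x) fun k hk => ?_
    have h1 := comb_taylor e J (fun k => c k x) hk
    have h2 := X_pow_dvd_trunc_mul_sub e (p := taylor (k : F) (p x))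
      (cofactor_mul_cofactorInv (F := F) e m k)
    have h3 := dvd_add h1 h2
    rwa [sub_add_sub_cancel] at h3
  have c1 : Computes S ((⋃ k ∈ Finset.range m, seg e (cf fun x => taylor (k : F) (p x))) ∪
        ((tables F Ω N ∪ levels F Ω e J) ∪ cofactorData F Ω e m))
      (⋃ k ∈ Finset.range m, seg e (cf (c k))) (m * (lam * e)) := by
    refine Computes.biUnion_lt fun k hk => ?_
    have heN : e ≤ N := by nlinarith
    refine (hC.series_mul heN (fun x => (taylor (k : F) (p x) : PowerSeries F))
      fun _ => cofactorInv F e m k).mono ?_ ?_ le_rfl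
    · refine Set.union_subset (fun v hv => .inl ?_) (fun v hv => .inr (.inr ?_))
      · simp only [Set.mem_iUnion, Finset.mem_range]
        obtain ⟨i, hi, rfl⟩ := hv
        exact ⟨k, hk, i, hi, by funext x; simp [cf, scf]⟩
      · simp only [cofactorData, Set.mem_iUnion, Finset.mem_range]
        exact ⟨k, hk, hv⟩
    · refine (seg_congr fun i hi => ?_).subset
      funext x
      simp only [cf, c, scf]
      rw [PowerSeries.coeff_trunc, if_pos hi]
  have c2 := c1.trans ((computes_comb hC hlam h0 hN le_rfl c hc).left
    (Set.union_subset Set.subset_union_right fun v hv => .inl (.inr (.inl hv))))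
  simp only [hcomb, ← hm] at c2
  refine c2.le ?_
  have hDN : ((e * m : ℕ) : ℝ) ≤ N := by exact_mod_cast (by omega)
  have h2 : lam * (e * m : ℕ) ≤ lam * N := mul_le_mul_of_nonneg_left hDN (by linarith)
  have h3 : lam * (e * m : ℕ) * J ≤ lam * N * J := mul_le_mul_of_nonneg_right h2 (by positivity)
  have h4 : 0 ≤ lam * N := by positivity
  rw [Nat.cast_mul] at h2 h3 ⊢
  nlinarith

end Interpolation

/-! ### Normal forms of operators and their action on functions -/

section NormalForm

variable {F : Type*} [Field F]

theorem del_mul_x : DiffOp.del F * DiffOp.x F = DiffOp.x F * DiffOp.del F + 1 := by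
  have := RingQuot.mkAlgHom_rel F (DiffRel.leibniz (F := F))
  simp only [map_mul, map_add, map_one] at this
  exact this

/-- The operators of bidegree less than `(n, m)`. -/
noncomputable def bidegreeLT (F : Type*) [Field F] (n m : ℕ) : Submodule F (DiffOp F) :=
  Submodule.span F (Set.range fun ij : Fin n × Fin m =>
    DiffOp.x F ^ (ij.1 : ℕ) * DiffOp.del F ^ (ij.2 : ℕ))

theorem mem_bidegreeLT {n m i l : ℕ} (hi : i < n) (hl : l < m) :
    DiffOp.x F ^ i * DiffOp.del F ^ l ∈ bidegreeLT F n m :=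
  Submodule.subset_span ⟨(⟨i, hi⟩, ⟨l, hl⟩), rfl⟩

/-- It suffices to check on the monomials that a linear map sends the operators of bounded bidegree
into `P`. -/
theorem bidegreeLT_induction {n m : ℕ} {P : Submodule F (DiffOp F)}
    {f : DiffOp F →ₗ[F] DiffOp F}
    (h : ∀ i < n, ∀ l < m, f (DiffOp.x F ^ i * DiffOp.del F ^ l) ∈ P) {u : DiffOp F}
    (hu : u ∈ bidegreeLT F n m) : f u ∈ P := by
  have : bidegreeLT F n m ≤ P.comap f := by
    rw [bidegreeLT, Submodule.span_le]
    rintro _ ⟨ij, rfl⟩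
    exact h _ ij.1.2 _ ij.2.2
  exact this hu

theorem del_mul_x_pow (i : ℕ) : DiffOp.del F * DiffOp.x F ^ i =
    DiffOp.x F ^ i * DiffOp.del F + (i : F) • DiffOp.x F ^ (i - 1) := by
  induction i with
  | zero => simp
  | succ i ih =>
    rw [pow_succ', ← mul_assoc, del_mul_x, add_mul, mul_assoc, ih]
    rcases i with _ | i
    · simp
    · simp only [Nat.add_sub_cancel, mul_add, mul_smul_comm, one_mul, ← pow_succ', ← mul_assoc]
      push_cast
      module

theorem del_mul_mem {n m : ℕ} {u : DiffOp F} (hu : u ∈ bidegreeLT F n m) :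
    DiffOp.del F * u ∈ bidegreeLT F n (m + 1) := by
  refine bidegreeLT_induction (f := LinearMap.mulLeft F (DiffOp.del F)) (fun i hi l hl => ?_) hu
  rw [LinearMap.mulLeft_apply, ← mul_assoc, del_mul_x_pow, add_mul, mul_assoc, ← pow_succ',
    smul_mul_assoc]
  exact add_mem (mem_bidegreeLT hi (by omega))
    (Submodule.smul_mem _ _ (mem_bidegreeLT (by omega) (by omega)))

theorem del_pow_mul_x_pow_mem (l i : ℕ) :
    DiffOp.del F ^ l * DiffOp.x F ^ i ∈ bidegreeLT F (i + 1) (l + 1) := by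
  induction l with
  | zero => simpa using mem_bidegreeLT (F := F) (Nat.lt_succ_self i) Nat.zero_lt_one
  | succ l ih =>
    rw [pow_succ', mul_assoc]
    exact del_mul_mem ih

theorem mul_mem_bidegreeLT {d r i l i' l' : ℕ} (hi : i < d) (hl : l < r) (hi' : i' < d)
    (hl' : l' < r) : (DiffOp.x F ^ i * DiffOp.del F ^ l) * (DiffOp.x F ^ i' * DiffOp.del F ^ l') ∈
      bidegreeLT F (2 * d) (2 * r) := by
  have h := bidegreeLT_induction (P := bidegreeLT F (2 * d) (2 * r))
    (f := LinearMap.mulLeft F (DiffOp.x F ^ i) ∘ₗ LinearMap.mulRight F (DiffOp.del F ^ l'))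
    (fun i₁ hi₁ l₁ hl₁ => ?_) (del_pow_mul_x_pow_mem (F := F) l i')
  · simpa only [LinearMap.comp_apply, LinearMap.mulLeft_apply, LinearMap.mulRight_apply,
      mul_assoc] using h
  · simp only [LinearMap.comp_apply, LinearMap.mulLeft_apply, LinearMap.mulRight_apply]
    rw [mul_assoc (DiffOp.x F ^ i₁), ← pow_add, ← mul_assoc, ← pow_add]
    exact mem_bidegreeLT (by omega) (by omega)

/-- The product of two operators of bidegree less than `(d, r)` has a normal form of bidegree less
than `(2 * d, 2 * r)`. -/
theorem exists_ofCoeffs_mul {d r : ℕ} (a b : Fin d × Fin r → F) :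
    ∃ c : Fin (2 * d) × Fin (2 * r) → F,
      DiffOp.ofCoeffs c = DiffOp.ofCoeffs a * DiffOp.ofCoeffs b := by
  have h : DiffOp.ofCoeffs a * DiffOp.ofCoeffs b ∈ bidegreeLT F (2 * d) (2 * r) := by
    rw [DiffOp.ofCoeffs, DiffOp.ofCoeffs, Finset.sum_mul_sum]
    refine sum_mem fun ij _ => sum_mem fun kl _ => ?_
    rw [smul_mul_smul_comm]
    exact Submodule.smul_mem _ _ (mul_mem_bidegreeLT ij.1.2 ij.2.2 kl.1.2 kl.2.2)
  exact (Submodule.mem_span_range_iff_exists_fun F).1 h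

/-- The action of the operators on `exp (α x) F[x]`, in terms of the polynomial factor: `∂` acts as
`D + α`. -/
noncomputable def rep (α : F) : DiffOp F →ₐ[F] Module.End F F[X] :=
  RingQuot.liftAlgHom F ⟨FreeAlgebra.lift F fun
    | .x => LinearMap.mulLeft F X
    | .partial_x => derivative + algebraMap F (Module.End F F[X]) α, by
    rintro _ _ ⟨⟩
    refine LinearMap.ext fun p => ?_
    simp only [map_mul, map_add, map_one, FreeAlgebra.lift_ι_apply, Module.End.mul_apply,
      LinearMap.add_apply, LinearMap.mulLeft_apply, Module.algebraMap_end_apply,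
      derivative_mul, derivative_X, Module.End.one_apply, mul_add, mul_smul_comm]
    ring⟩

theorem rep_x (α : F) : rep α (DiffOp.x F) = LinearMap.mulLeft F X := by
  simp [rep, DiffOp.x]

theorem rep_del (α : F) :
    rep α (DiffOp.del F) = derivative + algebraMap F (Module.End F F[X]) α := by
  simp [rep, DiffOp.del]

/-- The coefficient of `x ^ i * ∂ ^ l`, zero outside of the given range. -/
def coeffExt {d r : ℕ} (a : Fin d × Fin r → F) (i l : ℕ) : F :=
  if h : i < d ∧ l < r then a (⟨i, h.1⟩, ⟨l, h.2⟩) else 0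

/-- The polynomial `p i` in the expression `∑ x ^ i * p i (∂)` of an operator. -/
noncomputable def row {d r : ℕ} (a : Fin d × Fin r → F) (i : ℕ) : F[X] :=
  poly r (coeffExt a i)

theorem row_degree_lt {d r : ℕ} (a : Fin d × Fin r → F) (i : ℕ) : (row a i).degree < r :=
  poly_degree_lt _ _

theorem row_eq_zero {d r : ℕ} (a : Fin d × Fin r → F) {i : ℕ} (hi : d ≤ i) : row a i = 0 := by
  rw [row, poly]
  refine Finset.sum_eq_zero fun l _ => ?_
  rw [coeffExt, dif_neg (by omega), C_0, zero_mul]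

theorem row_coeff {d r : ℕ} (a : Fin d × Fin r → F) (i : Fin d) (l : Fin r) :
    (row a i).coeff l = a (i, l) := by
  rw [row, poly_coeff, if_pos l.2, coeffExt, dif_pos ⟨i.2, l.2⟩]

theorem ofCoeffs_eq_sum {d r : ℕ} (a : Fin d × Fin r → F) :
    DiffOp.ofCoeffs a =
      ∑ i ∈ Finset.range d, DiffOp.x F ^ i * aeval (DiffOp.del F) (row a i) := by
  rw [DiffOp.ofCoeffs, Fintype.sum_prod_type, Finset.sum_range]
  refine Finset.sum_congr rfl fun i _ => ?_
  rw [row, poly, map_sum, Finset.mul_sum, Finset.sum_range]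
  refine Finset.sum_congr rfl fun l _ => ?_
  rw [map_mul, aeval_C, map_pow, aeval_X, coeffExt, dif_pos ⟨i.2, l.2⟩, ← Algebra.smul_def,
    mul_smul_comm]

theorem aeval_derivative_X_pow (q : F[X]) {n : ℕ} (hq : q.degree < n) (j : ℕ) :
    aeval (derivative : Module.End F F[X]) q (X ^ j) =
      ∑ l ∈ Finset.range n, C (q.coeff l * (j.descFactorial l : F)) * X ^ (j - l) := by
  conv_lhs => rw [← poly_of_degree_lt hq]
  rw [poly, map_sum, LinearMap.sum_apply]
  refine Finset.sum_congr rfl fun l _ => ?_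
  rw [map_mul, aeval_C, aeval_X_pow, Module.End.mul_apply, Module.algebraMap_end_apply,
    Module.End.pow_apply, iterate_derivative_X_pow_eq_natCast_mul, smul_eq_C_mul, C_mul, mul_assoc]
  simp

theorem aeval_derivative_coeff [CharZero F] (q : F[X]) (j s : ℕ) :
    (aeval (derivative : Module.End F F[X]) q (X ^ j)).coeff s =
      if s ≤ j then (j.factorial : F) * (q.coeff (j - s) / s.factorial) else 0 := by
  have hq : q.degree < ((q.natDegree + 1 + j : ℕ) : WithBot ℕ) :=
    degree_le_natDegree.trans_lt (by exact_mod_cast (by omega))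
  rw [aeval_derivative_X_pow q hq, finsetSum_coeff]
  simp only [coeff_C_mul, coeff_X_pow]
  split_ifs with h
  · rw [Finset.sum_eq_single (j - s)]
    · rw [if_pos (by omega), mul_one]
      have h1 := Nat.factorial_mul_descFactorial (Nat.sub_le j s)
      rw [show j - (j - s) = s by omega] at h1
      have h2 : (s.factorial : F) ≠ 0 := Nat.cast_ne_zero.2 s.factorial_ne_zero
      rw [← h1]
      push_cast
      field_simp
    · intro l _ hl
      rcases le_or_gt l j with h' | h'
      · rw [if_neg (by omega), mul_zero]
      · rw [Nat.descFactorial_eq_zero_iff_lt.2 h']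
        simp
    · intro h'
      rw [Finset.mem_range] at h'
      omega
  · refine Finset.sum_eq_zero fun l _ => ?_
    rw [if_neg (by omega), mul_zero]

/-- The matrix of the action of the operator `∑ x ^ i * q i (D)`: its entry `(u, j)` is the coefficient
of `X ^ u` in the image of `X ^ j / j!`. With this scaling the entries on a diagonal are the
convolution of a diagonal of the array of coefficients with the sequence `1 / n!`. -/
noncomputable def actMat (q : ℕ → F[X]) (u j : ℕ) : F :=
  ∑ i ∈ Finset.range (u + 1),
    if u ≤ i + j then (q i).coeff (i + j - u) / ((u - i).factorial : F) else 0

theorem rep_ofCoeffs_apply {d r : ℕ} (a : Fin d × Fin r → F) (α : F) (p : F[X]) :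
    rep α (DiffOp.ofCoeffs a) p = ∑ i ∈ Finset.range d,
      X ^ i * aeval (derivative : Module.End F F[X]) (taylor α (row a i)) p := by
  rw [ofCoeffs_eq_sum, map_sum, LinearMap.sum_apply]
  refine Finset.sum_congr rfl fun i _ => ?_
  rw [map_mul, map_pow, rep_x, ← aeval_algHom_apply, rep_del, taylor_apply, aeval_comp,
    Module.End.mul_apply, ← LinearMap.mulLeft_apply (R := F)]
  congr 2
  · exact LinearMap.pow_mulLeft F F[X] X i
  · simp [aeval_C]

theorem rep_ofCoeffs_coeff [CharZero F] {d r : ℕ} (a : Fin d × Fin r → F) (α : F) (u j : ℕ) :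
    (rep α (DiffOp.ofCoeffs a) (X ^ j)).coeff u =
      (j.factorial : F) * actMat (fun i => taylor α (row a i)) u j := by
  rw [rep_ofCoeffs_apply, finsetSum_coeff, actMat, Finset.mul_sum]
  let f : ℕ → F := fun i => if i ≤ u ∧ u ≤ i + j then
    (j.factorial : F) * ((taylor α (row a i)).coeff (i + j - u) / ((u - i).factorial : F)) else 0
  have h1 : ∀ i, (X ^ i * aeval (derivative : Module.End F F[X]) (taylor α (row a i))
      (X ^ j)).coeff u = f i := by
    intro i
    rw [coeff_X_pow_mul', aeval_derivative_coeff]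
    simp only [f]
    by_cases h : i ≤ u
    · by_cases h' : u ≤ i + j
      · rw [if_pos h, if_pos (by omega), if_pos ⟨h, h'⟩, show j - (u - i) = i + j - u by omega]
      · rw [if_pos h, if_neg (by omega), if_neg (by omega)]
    · rw [if_neg h, if_neg (by omega)]
  have h2 : ∀ i ∈ Finset.range (u + 1), (j.factorial : F) * (if u ≤ i + j then
      (taylor α (row a i)).coeff (i + j - u) / ((u - i).factorial : F) else 0) = f i := by
    intro i hi
    rw [Finset.mem_range] at hi
    simp only [f, show i ≤ u by omega, true_and]
    split_ifs <;> simp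
  rw [Finset.sum_congr rfl fun i _ => h1 i, Finset.sum_congr rfl h2]
  have h3 : Finset.range d ⊆ Finset.range (d + u + 1) := Finset.range_subset_range.2 (by omega)
  have h4 : Finset.range (u + 1) ⊆ Finset.range (d + u + 1) :=
    Finset.range_subset_range.2 (by omega)
  rw [Finset.sum_subset h3, Finset.sum_subset h4]
  · intro i _ hi
    rw [Finset.mem_range] at hi
    exact if_neg (by omega)
  · intro i _ hi
    rw [Finset.mem_range] at hi
    rw [row_eq_zero a (show d ≤ i by omega)]
    simp

theorem actMat_eq_zero {d : ℕ} {q : ℕ → F[X]} (hq : ∀ i, d ≤ i → q i = 0) {u j : ℕ}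
    (h : d + j ≤ u) : actMat q u j = 0 := by
  refine Finset.sum_eq_zero fun i _ => ?_
  split_ifs with h'
  · rw [hq i (by omega)]
    simp
  · rfl

/-- The matrix of a product of operators is the product of the matrices, up to factorials. -/
theorem actMat_mul [CharZero F] {d r : ℕ} (a b : Fin d × Fin r → F)
    (c : Fin (2 * d) × Fin (2 * r) → F)
    (hc : DiffOp.ofCoeffs c = DiffOp.ofCoeffs a * DiffOp.ofCoeffs b) (α : F) {n j : ℕ}
    (hn : d + j ≤ n) (v : ℕ) :
    actMat (fun i => taylor α (row c i)) v j =
      ∑ u ∈ Finset.range n, (actMat (fun i => taylor α (row a i)) v u * (u.factorial : F)) *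
        actMat (fun i => taylor α (row b i)) u j := by
  have hj : (j.factorial : F) ≠ 0 := Nat.cast_ne_zero.2 j.factorial_ne_zero
  refine mul_left_cancel₀ hj ?_
  rw [← rep_ofCoeffs_coeff, hc, map_mul, Module.End.mul_apply]
  have hdeg : (rep α (DiffOp.ofCoeffs b) (X ^ j)).degree < n := by
    rw [degree_lt_iff_coeff_zero]
    intro u hu
    rw [rep_ofCoeffs_coeff, actMat_eq_zero (d := d) (fun i hi => ?_) (by omega), mul_zero]
    rw [row_eq_zero b hi, map_zero]
  conv_lhs => rw [← poly_of_degree_lt hdeg]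
  rw [poly, map_sum, finsetSum_coeff, Finset.mul_sum]
  refine Finset.sum_congr rfl fun u _ => ?_
  rw [← smul_eq_C_mul, map_smul, coeff_smul, rep_ofCoeffs_coeff, rep_ofCoeffs_coeff, smul_eq_mul]
  ring

end NormalForm

/-! ### Products of operators at one point -/

section Entries

variable {F : Type*} {Ω : Type*}

/-- The set of the entries `Y u j` with `u, j < B`. -/
def entries (B : ℕ) (Y : ℕ → ℕ → Ω → F) : Set (Ω → F) :=
  ⋃ u ∈ Finset.range B, seg B (Y u)

theorem mem_entries {B : ℕ} (Y : ℕ → ℕ → Ω → F) {u j : ℕ} (hu : u < B) (hj : j < B) :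
    Y u j ∈ entries B Y := by
  simp only [entries, Set.mem_iUnion, Finset.mem_range]
  exact ⟨u, hu, mem_seg _ hj⟩

theorem entries_subset {B : ℕ} {Y : ℕ → ℕ → Ω → F} {A : Set (Ω → F)}
    (h : ∀ u < B, ∀ j < B, Y u j ∈ A) : entries B Y ⊆ A := by
  intro v hv
  simp only [entries, Set.mem_iUnion, Finset.mem_range] at hv
  obtain ⟨u, hu, j, hj, rfl⟩ := hv
  exact h u hu j hj

end Entries

section Local

variable {F : Type*} [Field F] {Ω : Type*} {S : Set F} {N : ℕ} {lam : ℝ}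

/-- The diagonal `w` of the array of the coefficients of the `q i`, indexed by `i`. The offset `B` keeps
the indices of the diagonals nonnegative. -/
noncomputable def diag (B : ℕ) (q : ℕ → F[X]) (w i : ℕ) : F :=
  if B ≤ i + w then (q i).coeff (i + w - B) else 0

/-- The diagonal `w` of a matrix, indexed by the row, with the same offset `B`. -/
def matDiag (B : ℕ) (Y : ℕ → ℕ → F) (w u : ℕ) : F :=
  if B ≤ u + w then Y u (u + w - B) else 0

theorem matDiag_actMat (B : ℕ) (q : ℕ → F[X]) (w u : ℕ) :
    matDiag B (actMat q) w u =
      ∑ i ∈ Finset.range (u + 1), diag B q w i * (1 ^ (u - i) / ((u - i).factorial : F)) := by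
  rw [matDiag, actMat]
  split_ifs with h
  · refine Finset.sum_congr rfl fun i _ => ?_
    rw [diag]
    by_cases h' : B ≤ i + w
    · rw [if_pos (by omega), if_pos h', show i + (u + w - B) - u = i + w - B by omega, one_pow,
        mul_one_div]
    · rw [if_neg (by omega), if_neg h', zero_mul]
  · refine (Finset.sum_eq_zero fun i hi => ?_).symm
    rw [Finset.mem_range] at hi
    rw [diag, if_neg (by omega), zero_mul]

theorem exp_mul_exp_neg [CharZero F] :
    PowerSeries.mk (fun i => 1 ^ i / (i.factorial : F)) *
      PowerSeries.mk (fun i => (-1) ^ i / (i.factorial : F)) = 1 := by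
  have h := PowerSeries.exp_mul_exp_neg_eq_one (A := F)
  have h1 : PowerSeries.mk (fun i => 1 ^ i / (i.factorial : F)) = PowerSeries.exp F := by
    ext i
    simp [PowerSeries.coeff_exp]
  have h2 : PowerSeries.mk (fun i => (-1) ^ i / (i.factorial : F)) =
      PowerSeries.evalNegHom (PowerSeries.exp F) := by
    ext i
    simp [PowerSeries.evalNegHom, PowerSeries.coeff_rescale, PowerSeries.coeff_exp, div_eq_mul_inv]
  rw [h1, h2, h]

theorem diag_eq_sum [CharZero F] (B : ℕ) (q : ℕ → F[X]) (w i : ℕ) :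
    diag B q w i = ∑ u ∈ Finset.range (i + 1),
      matDiag B (actMat q) w u * ((-1) ^ (i - u) / ((i - u).factorial : F)) := by
  have h1 : PowerSeries.mk (matDiag B (actMat q) w) =
      PowerSeries.mk (diag B q w) * PowerSeries.mk (fun i => 1 ^ i / (i.factorial : F)) := by
    ext u
    rw [PowerSeries.coeff_mul, Finset.Nat.sum_antidiagonal_eq_sum_range_succ_mk]
    simp only [PowerSeries.coeff_mk]
    exact matDiag_actMat B q w u
  have h2 : PowerSeries.mk (diag B q w) = PowerSeries.mk (matDiag B (actMat q) w) *
      PowerSeries.mk (fun i => (-1) ^ i / (i.factorial : F)) := by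
    rw [h1, mul_assoc, exp_mul_exp_neg, mul_one]
  have h3 := congrArg (PowerSeries.coeff i) h2
  rw [PowerSeries.coeff_mul, Finset.Nat.sum_antidiagonal_eq_sum_range_succ_mk] at h3
  simpa only [PowerSeries.coeff_mk] using h3

/-- The entries of the matrix of an operator: one convolution for each diagonal. -/
theorem computes_actMat (hC : ConvBound S Ω N lam) (h0 : (0 : F) ∈ S) {d B : ℕ} (hB : B ≤ N)
    (q : ℕ → Ω → F[X]) (hq : ∀ i, d ≤ i → ∀ x, q i x = 0) :
    Computes S ((⋃ i ∈ Finset.range d, seg (d + B) (cf (q i))) ∪ seg B (expSeq Ω (1 : F)))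
      (entries B fun u j x => actMat (fun i => q i x) u j) ((2 * B : ℕ) * (lam * B)) := by
  refine (Computes.biUnion_lt (n := 2 * B) (t := lam * B)
    (B := fun w => seg B fun u x => matDiag B (actMat fun i => q i x) w u) fun w hw => ?_).right ?_
  · have c1 : Computes S ((⋃ i ∈ Finset.range d, seg (d + B) (cf (q i))) ∪ seg B (expSeq Ω (1 : F)))
        (seg B fun i x => diag B (fun i => q i x) w i) 0 := by
      refine .seg_free fun i hi => ?_
      rcases le_or_gt d i with hd | hd
      · exact .zero h0 fun x => by simp [diag, hq i hd x]
      · by_cases h : B ≤ i + w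
        · refine .of_mem (.inl ?_)
          simp only [Set.mem_iUnion, Finset.mem_range]
          refine ⟨i, hd, i + w - B, by simp only [Set.mem_Iio]; omega, ?_⟩
          funext x
          simp [diag, cf, h]
        · exact .zero h0 fun x => by simp [diag, h]
    refine (c1.trans ((hC B hB _ _ _ fun u _ x => matDiag_actMat B (fun i => q i x) w u).left
      (Set.union_subset Set.subset_union_right fun v hv => .inl (.inr hv)))).le (by simp)
  · refine entries_subset fun u hu j hj => ?_
    simp only [Set.mem_iUnion, Finset.mem_range]
    refine ⟨j + B - u, by omega, u, hu, ?_⟩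
    funext x
    simp only [matDiag]
    rw [if_pos (by omega), show u + (j + B - u) - B = j by omega]

/-- The coefficients of an operator, from the entries of its matrix: the inverse convolutions. Only the
entries in the first `d` columns have to be those of the operator, as no others contribute to the
coefficients of order less than `d` in `D`. -/
theorem computes_of_actMat [CharZero F] (hC : ConvBound S Ω N lam) (h0 : (0 : F) ∈ S) {d B : ℕ}
    (hB : B ≤ N) (hd : 3 * d ≤ B) (q : ℕ → Ω → F[X]) (Y : ℕ → ℕ → Ω → F)
    (hY : ∀ u < 2 * d, ∀ j < d, ∀ x, Y u j x = actMat (fun i => q i x) u j) :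
    Computes S (entries B Y ∪ seg B (expSeq Ω (-1 : F)))
      (⋃ i ∈ Finset.range (2 * d), seg d (cf (q i))) ((2 * B : ℕ) * (lam * (2 * d : ℕ))) := by
  let h : ℕ → ℕ → Ω → F := fun w i x => ∑ u ∈ Finset.range (i + 1),
    matDiag B (fun u j => Y u j x) w u * expSeq Ω (-1) (i - u) x
  have c1 : Computes S (entries B Y ∪ seg B (expSeq Ω (-1 : F)))
      (⋃ w ∈ Finset.range (d + B), seg (2 * d) (h w)) ((d + B : ℕ) * (lam * (2 * d : ℕ))) := by
    refine Computes.biUnion_lt fun w hw => ?_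
    have c1 : Computes S (entries B Y ∪ seg B (expSeq Ω (-1 : F)))
        (seg (2 * d) fun u x => matDiag B (fun u j => Y u j x) w u) 0 := by
      refine .seg_free fun u hu => ?_
      by_cases h : B ≤ u + w
      · have h' : (fun x => matDiag B (fun u j => Y u j x) w u) = Y u (u + w - B) :=
          funext fun x => if_pos h
        rw [h']
        exact .of_mem (.inl (mem_entries Y (by omega) (by omega)))
      · exact .zero h0 fun x => if_neg h
    refine (c1.trans ((hC (2 * d) (by omega) _ (expSeq Ω (-1)) (h w) fun u _ x => rfl).left
      (Set.union_subset Set.subset_union_right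
        fun v hv => .inl (.inr (seg_mono _ (by omega) hv))))).le (by simp)
  refine c1.mono subset_rfl ?_ ?_
  · intro v hv
    simp only [Set.mem_iUnion, Finset.mem_range] at hv ⊢
    obtain ⟨i, hi, l, hl, rfl⟩ := hv
    rw [Set.mem_Iio] at hl
    refine ⟨l + B - i, by omega, i, hi, ?_⟩
    funext x
    have h1 := diag_eq_sum B (fun i => q i x) (l + B - i) i
    rw [diag, if_pos (by omega), show i + (l + B - i) - B = l by omega] at h1
    simp only [cf, h, h1, expSeq]
    refine Finset.sum_congr rfl fun u hu => ?_
    rw [Finset.mem_range] at hu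
    congr 1
    simp only [matDiag]
    split_ifs with h2
    · exact hY u (by omega) _ (by omega) x
    · rfl
  · have hl : (0 : ℝ) ≤ lam * (2 * d : ℕ) := by
      obtain ⟨n, hn, -⟩ := hC (2 * d) (by omega) (fun _ _ => 0) (fun _ _ => 0) (fun _ _ => 0)
        (fun k _ x => by simp)
      exact le_trans (by positivity) hn
    refine mul_le_mul_of_nonneg_right ?_ hl
    exact_mod_cast (by omega)

theorem computes_matrix_mul [Nonempty Ω] {n : ℕ} {t : ℝ} (h : MatricesMulWithin S n t)
    (A B Y : ℕ → ℕ → Ω → F)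
    (hY : ∀ u < n, ∀ j < n, ∀ x, Y u j x = ∑ k ∈ Finset.range n, A u k x * B k j x) :
    Computes S (entries n A ∪ entries n B) (entries n Y) t := by
  obtain ⟨P, hc, hP⟩ := h
  refine (P.computes hc (Sum.elim (fun (ij : Fin n × Fin n) => A ij.1 ij.2)
    (fun (ij : Fin n × Fin n) => B ij.1 ij.2)) (fun (ij : Fin n × Fin n) => Y ij.1 ij.2)
    fun x => ?_).mono ?_ ?_ le_rfl
  · have := hP (Matrix.of fun i j => A i j x) (Matrix.of fun i j => B i j x)
    convert this using 2 with i ij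
    · rcases i with i | i <;> simp
    · rw [hY _ ij.1.2 _ ij.2.2, Matrix.mul_apply, Finset.sum_range]
      simp
  · rintro _ ⟨ij | ij, rfl⟩
    · exact .inl (mem_entries A ij.1.2 ij.2.2)
    · exact .inr (mem_entries B ij.1.2 ij.2.2)
  · exact entries_subset fun u hu j hj => ⟨(⟨u, hu⟩, ⟨j, hj⟩), rfl⟩

/-- The local coefficients of a product of operators, from those of the factors. The number `d + B` of
local coefficients covers all diagonals that meet a `B × B` matrix. -/
theorem computes_local [Nonempty Ω] [CharZero F] (hC : ConvBound S Ω N lam) (h0 : (0 : F) ∈ S)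
    {d B : ℕ} (hBN : B ≤ N) (hd : 3 * d ≤ B) {t : ℝ} (hM : MatricesMulWithin S B t)
    (p q s : ℕ → Ω → F[X]) (hp : ∀ i, d ≤ i → ∀ x, p i x = 0) (hq : ∀ i, d ≤ i → ∀ x, q i x = 0)
    (hs : ∀ v j, j < d → ∀ x, actMat (fun i => s i x) v j = ∑ u ∈ Finset.range B,
      (actMat (fun i => p i x) v u * (u.factorial : F)) * actMat (fun i => q i x) u j) :
    Computes S (((⋃ i ∈ Finset.range d, seg (d + B) (cf (p i))) ∪
          (⋃ i ∈ Finset.range d, seg (d + B) (cf (q i)))) ∪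
        (tables F Ω N ∪ (seg B (expSeq Ω (1 : F)) ∪ seg B (expSeq Ω (-1 : F)))))
      (⋃ i ∈ Finset.range (2 * d), seg d (cf (s i))) (6 * lam * B * B + B * B + t) := by
  set P₁ : Set (Ω → F) := ⋃ i ∈ Finset.range d, seg (d + B) (cf (p i))
  set Q₁ : Set (Ω → F) := ⋃ i ∈ Finset.range d, seg (d + B) (cf (q i))
  set T := tables F Ω N
  set E₁ := seg B (expSeq Ω (1 : F))
  set E₂ := seg B (expSeq Ω (-1 : F))
  let mp : ℕ → ℕ → Ω → F := fun u j x => actMat (fun i => p i x) u j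
  let mp' : ℕ → ℕ → Ω → F := fun u j x => mp u j x * (j.factorial : F)
  let mq : ℕ → ℕ → Ω → F := fun u j x => actMat (fun i => q i x) u j
  let Y : ℕ → ℕ → Ω → F := fun u j x => ∑ k ∈ Finset.range B, mp' u k x * mq k j x
  set A := (P₁ ∪ Q₁) ∪ (T ∪ (E₁ ∪ E₂))
  have c1 : Computes S A (entries B mp) ((2 * B : ℕ) * (lam * B)) :=
    (computes_actMat hC h0 hBN p hp).left
      (Set.union_subset (fun v hv => .inl (.inl hv)) fun v hv => .inr (.inr (.inl hv)))
  have c2 : Computes S A (entries B mq) ((2 * B : ℕ) * (lam * B)) :=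
    (computes_actMat hC h0 hBN q hq).left
      (Set.union_subset (fun v hv => .inl (.inr hv)) fun v hv => .inr (.inr (.inl hv)))
  have c3 : Computes S A (entries B mp') ((2 * B : ℕ) * (lam * B) + B * (B * 1)) := by
    refine c1.trans (Computes.biUnion_lt fun u hu => Computes.seg fun j hj => ?_)
    exact .mul_eq (.of_mem (.inr (mem_entries mp hu hj)))
      (.of_mem (.inl (.inr (.inl (.inr (mem_seg (factSeq F Ω) (show j < N by omega)))))))
      (by norm_num) fun x => rfl
  have c4 := (c3.union c2).trans ((computes_matrix_mul hM mp' mq Y fun u _ j _ x => rfl).left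
    Set.subset_union_right)
  refine (c4.trans ((computes_of_actMat hC h0 hBN hd s Y fun u _ j hj x => ?_).left
    (Set.union_subset Set.subset_union_right fun v hv => .inl (.inr (.inr (.inr hv)))))).le ?_
  · exact (hs u j hj x).symm
  · have hl : (0 : ℝ) ≤ lam * B := by
      obtain ⟨n, hn, -⟩ := hC B hBN (fun _ _ => 0) (fun _ _ => 0) (fun _ _ => 0)
        (fun k _ x => by simp)
      exact le_trans (by positivity) hn
    have hdB : (3 : ℝ) * d ≤ B := by exact_mod_cast hd
    rcases Nat.eq_zero_or_pos B with rfl | hB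
    · have : d = 0 := by omega
      subst this
      simp
    have hB' : (0 : ℝ) < B := by exact_mod_cast hB
    have hlam : 0 ≤ lam := nonneg_of_mul_nonneg_left hl hB'
    have h1 : lam * B * (3 * d) ≤ lam * B * B := mul_le_mul_of_nonneg_left hdB hl
    have h2 : 0 ≤ lam * B * d := by positivity
    push_cast
    nlinarith

end Local

/-! ### Products of operators -/

section Product

variable {F : Type*} [Field F] [CharZero F] {Ω : Type*} {S : Set F} {N : ℕ} {lam : ℝ}

/-- All constants that depend only on the parameters: the factors are expanded with multiplicity
`4 * d`, the product is interpolated with multiplicity `d`, and the matrices have size `3 * d`. -/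
def productData (F Ω : Type*) [Field F] (N d J : ℕ) : Set (Ω → F) :=
  (evalData F Ω N (4 * d) J ∪ (levels F Ω d J ∪ cofactorData F Ω d (2 ^ J))) ∪
    (tables F Ω N ∪ (seg (3 * d) (expSeq Ω (1 : F)) ∪ seg (3 * d) (expSeq Ω (-1 : F))))

theorem computes_productData (hC : ConvBound S Ω N lam) (hlam : 1 ≤ lam) (h0 : (0 : F) ∈ S)
    (h1 : (1 : F) ∈ S) {d J s : ℕ} (hd : 1 ≤ d) (hN : 4 * d * 2 ^ J + 1 ≤ N)
    (hs : 4 * d * 2 ^ J ≤ 2 ^ s) (A : Set (Ω → F)) :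
    Computes S A (productData F Ω N d J) (48 * (d * lam * N * (s + 1))) := by
  set m := 2 ^ J with hm
  have hm0 : 1 ≤ m := Nat.one_le_two_pow
  have hJs : J ≤ s := by
    refine (Nat.pow_le_pow_iff_right (show 1 < 2 by norm_num)).1 (le_trans ?_ hs)
    nlinarith
  have hdm : d * m ≤ N := by nlinarith
  have hdN : d ≤ N := by nlinarith
  have hmN : m < N := by nlinarith
  have h3d : 3 * d ≤ N := by nlinarith
  have h1N : 1 < N := by nlinarith
  have ct := computes_tables h0 h1 N A
  have c1 := computes_evalData hC hlam h0 h1 (show 0 < 4 * d by omega) hN hs A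
  have c2 := (computes_levels (Ω := Ω) hC hlam h0 h1 (show 0 < d by omega) J (by nlinarith)).right
    Set.subset_union_left
  have c3 := computes_cofactorData hC h0 h1 (e := d) (m := m) (Ω := Ω) hdN hmN
  have c4 : Computes S (tables F Ω N) (seg (3 * d) (expSeq Ω (1 : F))) (0 + 2 * (3 * d : ℕ)) :=
    (Computes.const h1).trans ((computes_expSeq h1 1 (3 * d)).left
      (Set.union_subset_union_left _ fun v hv => .inl (seg_mono _ h3d hv)))
  have c5 : Computes S (tables F Ω N) (seg (3 * d) (expSeq Ω (-1 : F))) (1 + 2 * (3 * d : ℕ)) := by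
    have h := (computes_neg_natCast (S := S) (Ω := Ω) (F := F) h0 h1N).trans
      ((computes_expSeq h1 _ (3 * d)).left
        (Set.union_subset_union_left _ fun v hv => .inl (seg_mono _ h3d hv)))
    simpa only [Nat.cast_one] using h
  have c6 := c1.seq ((ct.seq (((c2.union c3).union (c4.union c5)).left
    Set.subset_union_right)).left (A' := A ∪ evalData F Ω N (4 * d) J) Set.subset_union_left)
  refine c6.mono subset_rfl ?_ ?_
  · rintro v ((hv | hv) | (hv | hv))
    · exact .inl hv
    · exact .inr (.inr (.inl hv))
    · exact .inr (.inl hv)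
    · exact .inr (.inr (.inr hv))
  · have hdR : (1 : ℝ) ≤ d := by exact_mod_cast hd
    have hmR : (1 : ℝ) ≤ m := by exact_mod_cast hm0
    have hNR : (1 : ℝ) ≤ N := by exact_mod_cast h1N.le
    have hJR : (J : ℝ) ≤ s := by exact_mod_cast hJs
    have hdmR : (d : ℝ) * m ≤ N := by exact_mod_cast hdm
    have hdNR : (d : ℝ) ≤ N := by exact_mod_cast hdN
    set Q : ℝ := d * lam * N * (s + 1) with hQ
    have hs0 : (0 : ℝ) ≤ s := by positivity
    have e1 : lam * N * (s + 1) ≤ Q := by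
      rw [hQ, mul_assoc (d : ℝ), mul_assoc (d : ℝ)]
      exact le_mul_of_one_le_left (by positivity) hdR
    have e2 : lam * N ≤ lam * N * (s + 1) := le_mul_of_one_le_right (by positivity) (by linarith)
    have e3 : lam * N * J ≤ lam * N * s := mul_le_mul_of_nonneg_left hJR (by positivity)
    have e4 : (N : ℝ) ≤ lam * N := le_mul_of_one_le_left (by positivity) hlam
    have e5 : (m : ℝ) * (lam * d) ≤ lam * N := by
      have := mul_le_mul_of_nonneg_left hdmR (show 0 ≤ lam by linarith)
      linarith
    have e6 : (m : ℝ) * d * d ≤ Q := by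
      have h2 : (d : ℝ) * m * d ≤ N * d := mul_le_mul_of_nonneg_right hdmR (by positivity)
      have h3 : d * (N : ℝ) ≤ d * (lam * N * (s + 1)) :=
        mul_le_mul_of_nonneg_left (by linarith) (by positivity)
      rw [hQ]
      linarith
    have e7 : 2 * ((m : ℝ) + 1) * (1 + 2 * d * d) ≤ 12 * (m * d * d) := by
      have h2 : (1 : ℝ) ≤ d * d := by nlinarith
      have h3 : (m + 1) * (1 + 2 * d * d) ≤ (2 * m) * (3 * (d * d) : ℝ) :=
        mul_le_mul (by linarith) (by linarith) (by positivity) (by positivity)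
      linarith
    push_cast
    linarith

/-- The coefficients of a product of operators of bidegree less than `(d, r)`, for `2 ^ J` points of
expansion and multiplicity `d`, with `2 * r ≤ d * 2 ^ J`. -/
theorem computes_product [Nonempty Ω] (hC : ConvBound S Ω N lam) (hlam : 1 ≤ lam)
    (h0 : (0 : F) ∈ S) (h1 : (1 : F) ∈ S) {d r J s : ℕ} (hd : 1 ≤ d)
    (hr : 2 * r ≤ d * 2 ^ J) (hN : 4 * d * 2 ^ J + 1 ≤ N) (hs : 4 * d * 2 ^ J ≤ 2 ^ s) {t : ℝ}
    (hM : MatricesMulWithin S (3 * d) t) (a b : Ω → Fin d × Fin r → F)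
    (c : Ω → Fin (2 * d) × Fin (2 * r) → F)
    (hc : ∀ x, DiffOp.ofCoeffs (c x) = DiffOp.ofCoeffs (a x) * DiffOp.ofCoeffs (b x)) :
    Computes S (Set.range (fun ij x => a x ij) ∪ Set.range (fun ij x => b x ij))
      (Set.range fun ij x => c x ij)
      (139 * (d * lam * N * (s + 1)) + (2 ^ J : ℕ) * t) := by
  set m := 2 ^ J with hm
  have hm0 : 1 ≤ m := Nat.one_le_two_pow
  set A : Set (Ω → F) := Set.range (fun ij x => a x ij) ∪ Set.range (fun ij x => b x ij)
  set T := productData F Ω N d J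
  let loc : ℕ → (Ω → F[X]) → ℕ → Set (Ω → F) := fun e p k =>
    seg e (cf fun x => taylor (k : F) (p x))
  have hrow : ∀ (u : Ω → Fin d × Fin r → F), Set.range (fun ij x => u x ij) ⊆ A → ∀ i < d,
      Computes S (A ∪ T) (⋃ k ∈ Finset.range m, loc (4 * d) (fun x => row (u x) i) k)
        (7 * lam * N * (J + 1)) := by
    intro u hu i hi
    have hcf : Computes S (A ∪ T) (seg (4 * d * m) (cf fun x => row (u x) i)) 0 := by
      refine .seg_free fun l _ => ?_
      by_cases hl : l < r
      · have : cf (fun x => row (u x) i) l = fun x => u x (⟨i, hi⟩, ⟨l, hl⟩) :=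
          funext fun x => row_coeff (u x) ⟨i, hi⟩ ⟨l, hl⟩
        rw [this]
        exact .of_mem (.inl (hu ⟨_, rfl⟩))
      · refine .zero h0 fun x => cf_eq_zero (fun x => row_degree_lt (u x) i) (by omega) x
    refine (hcf.trans ((computes_eval hC hlam h0 (show 0 < 4 * d by omega) hN
      (fun x => row (u x) i) fun x => (row_degree_lt (u x) i).trans_le ?_).left ?_)).le (by simp)
    · exact_mod_cast (by nlinarith)
    · exact Set.union_subset Set.subset_union_right fun v hv => .inl (.inr (.inl (.inl hv)))
  let La : Set (Ω → F) := ⋃ i ∈ Finset.range d, ⋃ k ∈ Finset.range m,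
    loc (4 * d) (fun x => row (a x) i) k
  let Lb : Set (Ω → F) := ⋃ i ∈ Finset.range d, ⋃ k ∈ Finset.range m,
    loc (4 * d) (fun x => row (b x) i) k
  let Lc : Set (Ω → F) := ⋃ k ∈ Finset.range m, ⋃ i ∈ Finset.range (2 * d),
    loc d (fun x => row (c x) i) k
  have c1 : Computes S A T (48 * (d * lam * N * (s + 1))) :=
    computes_productData hC hlam h0 h1 hd hN hs A
  have c2 : Computes S (A ∪ T) (La ∪ Lb)
      (d * (7 * lam * N * (J + 1)) + d * (7 * lam * N * (J + 1))) :=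
    (Computes.biUnion_lt (hrow a Set.subset_union_left)).union
      (Computes.biUnion_lt (hrow b Set.subset_union_right))
  have hsub : ∀ u : Ω → Fin d × Fin r → F, ∀ k < m,
      (⋃ i ∈ Finset.range d, seg (d + 3 * d) (cf fun x => taylor (k : F) (row (u x) i))) ⊆
        ⋃ i ∈ Finset.range d, ⋃ k ∈ Finset.range m, loc (4 * d) (fun x => row (u x) i) k := by
    intro u k hk v hv
    simp only [Set.mem_iUnion, Finset.mem_range, loc] at hv ⊢
    obtain ⟨i, hi, hv⟩ := hv
    rw [show d + 3 * d = 4 * d by ring] at hv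
    exact ⟨i, hi, k, hk, hv⟩
  have c3 : Computes S ((A ∪ T) ∪ (La ∪ Lb)) Lc
      (m * (6 * lam * (3 * d : ℕ) * (3 * d : ℕ) + (3 * d : ℕ) * (3 * d : ℕ) + t)) := by
    refine Computes.biUnion_lt fun k hk => ?_
    refine (computes_local hC h0 (show 3 * d ≤ N by nlinarith) le_rfl hM
      (fun i x => taylor (k : F) (row (a x) i)) (fun i x => taylor (k : F) (row (b x) i))
      (fun i x => taylor (k : F) (row (c x) i)) ?_ ?_ ?_).left ?_
    · intro i hi x
      rw [row_eq_zero _ hi, map_zero]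
    · intro i hi x
      rw [row_eq_zero _ hi, map_zero]
    · intro v j hj x
      exact actMat_mul (a x) (b x) (c x) (hc x) (k : F) (by omega) v
    · refine Set.union_subset (Set.union_subset ?_ ?_) fun v hv => .inl (.inr (.inr hv))
      · exact fun v hv => .inr (.inl (hsub a k hk hv))
      · exact fun v hv => .inr (.inr (hsub b k hk hv))
  have c4 : Computes S ((A ∪ T) ∪ Lc)
      (⋃ i ∈ Finset.range (2 * d), seg (d * m) (cf fun x => row (c x) i))
      ((2 * d : ℕ) * (7 * lam * N * (J + 1))) := by
    refine Computes.biUnion_lt fun i hi => ?_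
    refine (computes_interp hC hlam h0 (show d * 2 ^ J + 1 ≤ N by nlinarith)
      (fun x => row (c x) i) fun x => (row_degree_lt (c x) i).trans_le ?_).left ?_
    · exact_mod_cast hr
    · refine Set.union_subset (fun v hv => .inr ?_) (Set.union_subset (Set.union_subset
        (fun v hv => .inl (.inr (.inr (.inl hv))))
        fun v hv => .inl (.inr (.inl (.inr (.inl hv)))))
        fun v hv => .inl (.inr (.inl (.inr (.inr hv)))))
      simp only [Lc, Set.mem_iUnion, Finset.mem_range, loc] at hv ⊢
      obtain ⟨k, hk, hv⟩ := hv
      exact ⟨k, hk, i, hi, hv⟩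
  have c5 := c1.trans ((c2.trans c3).seq c4 |>.right Set.subset_union_right)
  refine c5.mono subset_rfl ?_ ?_
  · rintro _ ⟨ij, rfl⟩
    simp only [Set.mem_iUnion, Finset.mem_range]
    refine ⟨ij.1, ij.1.2, ij.2, ij.2.2.trans_le hr, ?_⟩
    funext x
    exact row_coeff (c x) ij.1 ij.2
  · have hJs : J ≤ s := by
      refine (Nat.pow_le_pow_iff_right (show 1 < 2 by norm_num)).1 (le_trans ?_ hs)
      nlinarith
    have hdm : d * m ≤ N := by nlinarith
    have hJR : (J : ℝ) ≤ s := by exact_mod_cast hJs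
    have hdmR : (d : ℝ) * m ≤ N := by exact_mod_cast hdm
    set Q : ℝ := d * lam * N * (s + 1) with hQ
    have hs0 : (0 : ℝ) ≤ s := by positivity
    have hdl : 0 ≤ d * lam * N := by positivity
    have e1 : d * lam * N * (J + 1) ≤ Q := mul_le_mul_of_nonneg_left (by linarith) hdl
    have e2 : d * lam * N ≤ Q := le_mul_of_one_le_right hdl (by linarith)
    have e3 : m * (lam * (d * d)) ≤ d * lam * N := by
      have := mul_le_mul_of_nonneg_left hdmR (show 0 ≤ d * lam by positivity)
      linarith
    have e4 : m * ((d : ℝ) * d) ≤ m * (lam * (d * d)) := by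
      refine mul_le_mul_of_nonneg_left ?_ (by positivity)
      exact le_mul_of_one_le_left (by positivity) hlam
    push_cast
    linarith

end Product

section Parameters

/-- The depth of the trees: `2 ^ J` points of multiplicity `d` determine a polynomial of degree less
than `2 * r`, and multiplicity `4 * d` stays below the length `16 * r`. -/
theorem exists_depth {d r : ℕ} (hd : 1 ≤ d) (hdr : d ≤ r) :
    ∃ J : ℕ, 2 * r ≤ d * 2 ^ J ∧ d * 2 ^ J < 4 * r := by
  classical
  have hex : ∃ J : ℕ, 2 * r ≤ d * 2 ^ J :=
    ⟨2 * r, (Nat.lt_two_pow_self).le.trans (Nat.le_mul_of_pos_left _ hd)⟩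
  refine ⟨Nat.find hex, Nat.find_spec hex, ?_⟩
  have h0 : Nat.find hex ≠ 0 := by
    intro h
    have := Nat.find_spec hex
    rw [h] at this
    omega
  obtain ⟨j, hj⟩ := Nat.exists_eq_succ_of_ne_zero h0
  have h1 := Nat.find_min hex (show j < Nat.find hex by omega)
  rw [hj, pow_succ, ← mul_assoc]
  omega

theorem clog_add_one_le {r : ℕ} (hr : 2 ≤ r) :
    (Nat.clog 2 (16 * r) : ℝ) + 1 ≤ 14 * Real.log r := by
  have hr0 : (0 : ℝ) < r := by positivity
  have h1 : 2 ^ (Nat.clog 2 (16 * r)).pred < 16 * r :=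
    Nat.pow_pred_clog_lt_self (by norm_num) (by omega)
  have h2 : (Nat.clog 2 (16 * r) : ℝ) ≤ (Nat.clog 2 (16 * r)).pred + 1 := by
    exact_mod_cast (by have := Nat.pred_eq_sub_one (n := Nat.clog 2 (16 * r)); omega)
  have h3 : ((Nat.clog 2 (16 * r)).pred : ℝ) * Real.log 2 ≤ 4 * Real.log 2 + Real.log r := by
    have h4 : (2 : ℝ) ^ (Nat.clog 2 (16 * r)).pred ≤ 2 ^ 4 * r := by
      have : ((2 ^ (Nat.clog 2 (16 * r)).pred : ℕ) : ℝ) ≤ (16 * r : ℕ) := by exact_mod_cast h1.le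
      push_cast at this
      linarith
    have h5 := Real.log_le_log (by positivity) h4
    rw [Real.log_pow, Real.log_mul (by norm_num) hr0.ne', Real.log_pow] at h5
    exact_mod_cast h5
  have h6 : Real.log 2 ≤ Real.log r := Real.log_le_log (by norm_num) (by exact_mod_cast hr)
  have h7 : (1 : ℝ) / 2 < Real.log 2 := by linarith [Real.log_two_gt_d9]
  have h8 : ((Nat.clog 2 (16 * r)).pred + 2 : ℝ) * Real.log 2 ≤ 7 * Real.log r := by nlinarith
  have h9 : (0 : ℝ) ≤ (Nat.clog 2 (16 * r)).pred + 2 := by positivity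
  nlinarith

end Parameters

end OpMul

theorem theorem3 {F : Type*} [Field F] [CharZero F]
    (S : Set F) (h_zero : (0 : F) ∈ S) (h_one : (1 : F) ∈ S)
    (M : ℕ → ℝ) (hM : ∀ n : ℕ, 1 ≤ n → PolynomialsMulWithin S n (M n))
    (hM_mono : MonotoneOn (fun n : ℕ => M n / (n : ℝ)) (Set.Ici 1))
    (ω : ℝ) (hω_two : 2 ≤ ω) (hω_three : ω ≤ 3)
    (hω : ∃ B : ℝ, ∀ n : ℕ, 1 ≤ n → MatricesMulWithin S n (B * (n : ℝ) ^ ω)) :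
    ∃ C : ℝ, ∀ d r : ℕ, 1 ≤ d → d ≤ r →
      OperatorsMulWithin S d r
        (C * ((d : ℝ) ^ (ω - 1) * (r : ℝ) + (d : ℝ) * M r * Real.log r)) := by
  obtain ⟨B, hB⟩ := hω
  have hB0 : 0 ≤ B := by
    obtain ⟨P, hP, -⟩ := hB 1 le_rfl
    simpa using (Nat.cast_nonneg P.cost).trans hP
  have hM1 : 1 ≤ M 1 := OpMul.one_le_of_polynomialsMulWithin_one (hM 1 le_rfl)
  -- The second summand covers `r = 1`, where the logarithm vanishes. The factor `2 ^ 20` is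
  -- `65536 * 16`, the cost of a convolution of length `16 * r` being `65536 * 16 * M r`.
  refine ⟨139 * 2 ^ 20 * 14 + 139 * 2 ^ 20 * 5 * M 1 + 108 * B, fun d r hd hdr => ?_⟩
  obtain ⟨J, hJ, hJ'⟩ := OpMul.exists_depth hd hdr
  obtain ⟨hMr, hC⟩ := OpMul.convBound_of_polynomialsMulWithin
    (Ω := (Fin d × Fin r) ⊕ (Fin d × Fin r) → F) h_zero hM hM_mono (hd.trans hdr)
  choose c hc using fun x : (Fin d × Fin r) ⊕ (Fin d × Fin r) → F =>
    OpMul.exists_ofCoeffs_mul (fun ij => x (.inl ij)) (fun ij => x (.inr ij))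
  have hs : 4 * d * 2 ^ J ≤ 2 ^ Nat.clog 2 (16 * r) :=
    le_trans (by linarith) (Nat.le_pow_clog (by norm_num) _)
  have hcomp := OpMul.computes_product hC (by linarith) h_zero h_one hd hJ (by linarith) hs
    (hB (3 * d) (by omega)) (fun x ij => x (.inl ij)) (fun x ij => x (.inr ij)) c hc
  have hcomp' := hcomp.left (A' := Set.range fun i x => x i) (by
    rintro _ (⟨ij, rfl⟩ | ⟨ij, rfl⟩)
    · exact ⟨.inl ij, rfl⟩
    · exact ⟨.inr ij, rfl⟩)
  obtain ⟨P, hP, hPout⟩ := hcomp'.exists_slp (fun ij x => c x ij) fun ij => ⟨ij, rfl⟩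
  refine ⟨P, hP.trans ?_, fun a b => ⟨_, hPout _, hc (Sum.elim a b)⟩⟩
  have hd0 : (0 : ℝ) < d := by exact_mod_cast hd
  have hr0 : (0 : ℝ) < r := by exact_mod_cast (hd.trans hdr)
  have hMr0 : (r : ℝ) ≤ M r := by rwa [one_le_div hr0] at hMr
  have hlog : 0 ≤ Real.log r := Real.log_natCast_nonneg r
  have hdp : 0 ≤ (d : ℝ) ^ (ω - 1) := by positivity
  have hmat : ((2 ^ J : ℕ) : ℝ) * (B * ((3 * d : ℕ) : ℝ) ^ ω) ≤
      108 * B * ((d : ℝ) ^ (ω - 1) * r) := by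
    have e1 : ((3 * d : ℕ) : ℝ) ^ ω = 3 ^ ω * ((d : ℝ) ^ (ω - 1) * d) := by
      rw [Nat.cast_mul, Real.mul_rpow (by norm_num) hd0.le, Real.rpow_sub_one hd0.ne',
        div_mul_cancel₀ _ hd0.ne']
      norm_num
    have e2 : (3 : ℝ) ^ ω ≤ 27 := by
      calc (3 : ℝ) ^ ω ≤ 3 ^ (3 : ℝ) := Real.rpow_le_rpow_of_exponent_le (by norm_num) hω_three
        _ = 27 := by norm_num
    have e3 : (d : ℝ) * (2 ^ J : ℕ) ≤ 4 * r := by exact_mod_cast hJ'.le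
    rw [e1]
    calc ((2 ^ J : ℕ) : ℝ) * (B * (3 ^ ω * ((d : ℝ) ^ (ω - 1) * d)))
        = (B * (d : ℝ) ^ (ω - 1)) * (3 ^ ω * (d * (2 ^ J : ℕ))) := by ring
      _ ≤ (B * (d : ℝ) ^ (ω - 1)) * (27 * (4 * r)) := by
          refine mul_le_mul_of_nonneg_left ?_ (by positivity)
          exact mul_le_mul e2 e3 (by positivity) (by norm_num)
      _ = _ := by ring
  have hN : (d : ℝ) * (65536 * (M r / r)) * (16 * r : ℕ) = 2 ^ 20 * (d * M r) := by
    push_cast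
    field_simp
    ring
  rw [hN]
  have hdM : 0 ≤ d * M r * Real.log r := by
    have : 0 ≤ M r := hr0.le.trans hMr0
    positivity
  have hdr0 : 0 ≤ (d : ℝ) ^ (ω - 1) * r := by positivity
  rcases (show r = 1 ∨ 2 ≤ r by omega) with rfl | hr2
  · obtain rfl : d = 1 := by omega
    have h5 : Nat.clog 2 (16 * 1) = 4 := by
      rw [show 16 * 1 = 2 ^ 4 by norm_num, Nat.clog_pow 2 4 (by norm_num)]
    rw [h5]
    simp only [Nat.cast_one, Real.one_rpow, Real.log_one] at hmat ⊢
    push_cast at hmat ⊢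
    nlinarith
  · have hclog := OpMul.clog_add_one_le hr2
    have e1 : (d : ℝ) * M r * (Nat.clog 2 (16 * r) + 1) ≤ d * M r * (14 * Real.log r) :=
      mul_le_mul_of_nonneg_left hclog (mul_nonneg hd0.le (hr0.le.trans hMr0))
    have e2 : 0 ≤ M 1 * ((d : ℝ) ^ (ω - 1) * r) := by positivity
    have e3 : 0 ≤ M 1 * (d * M r * Real.log r) := by positivity
    have e4 : 0 ≤ B * (d * M r * Real.log r) := by positivity
    linarith
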